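/- All Hilbert spaces are finite-dimensional and nonzero, with fixed orthonormal bases; $\pi_A=\mathbb{1}_A/d_A$; $\mathcal R^\pi_A(\cdot)=\mathrm{tr}_A[\cdot]\otimes\pi_A$ is the replacement channel; $\|\mathcal F\|_\diamond=\sup_{k}\sup_{\|X\|_1\le1}\|(\mathcal F\otimes\mathrm{id}_k)(X)\|_1$. For an operator $X$ on $A_0A_1B_0B_1$, a subscript such as $X_{A_0B_0B_1}$ denotes the marginal obtained by tracing out the systems that are not listed. The Choi operator of a bipartite channel $\mathcal N_{A_0B_0\to A_1B_1}$ is $J^{\mathcal N}=\sum_{i,j}|i\rangle\langle j|_{A_0B_0}\otimes\mathcal N(|i\rangle\langle j|)$, with $i,j$ ranging over the basis of $A_0B_0$. A superchannel $\Theta_{(\bar A_0\bar B_0\to\bar A_1\bar B_1)\to(A_0B_0\to A_1B_1)}$ is a linear map from the linear maps $\mathscr L(\bar A_0\bar B_0)\to\mathscr L(\bar A_1\bar B_1)$ to the linear maps $\mathscr L(A_0B_0)\to\mathscr L(A_1B_1)$ such that $\mathbb I_R\otimes\Theta$ sends quantum channels to quantum channels for all reference systems $R_0,R_1$ (where $\mathbb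 I_R$ is the identity supermap on maps from $R_0$ to $R_1$). It is non-signalling if, for every linear map $\mathcal M:\mathscr L(\bar A_0\bar B_0)\to\mathscr L(\bar A_1\bar B_1)$, $$\mathcal R^\pi_{A_1}\circ\Theta(\mathcal M\circ\mathcal R^\pi_{\bar A_0})\circ\mathcal R^\pi_{A_0}=\mathcal R^\pi_{A_1}\circ\Theta(\mathcal M\circ\mathcal R^\pi_{\bar A_0}),\qquad \mathcal R^\pi_{A_1}\circ\Theta(\mathcal R^\pi_{\bar A_1}\circ\mathcal M)=\mathcal R^\pi_{A_1}\circ\Theta(\mathcal M),$$ and the same two identities hold with $B$ in place of $A$. The minimum error of simulating $\mathcal N_{A_0B_0\to A_1B_1}$ from a bipartite channel $\mathcal M_{\bar A_0\bar B_0\to\bar A_1\bar B_1}$ is $$e_{\mathrm{NS}}(\mathcal M,\mathcal N)=\tfrac12\inf_\Theta\|\Theta(\mathcal M)-\mathcal N\|_\diamond,$$ the infimum being over all non-signalling bipartite superchannels $\Theta$. For an integer $m\ge1$ let $\Upsilon_m(\cdot)=\sum_{k,l=0}^{m-1}\langle kl|\cdot|kl\rangle\,|lk\rangle\langle lk|$,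 from $\bar A_0\bar B_0$ to $\bar A_1\bar B_1$ with all four systems of dimension $m$, be the bidirectional noiseless classical channel. **Proposition.** For every bipartite quantum channel $\mathcal N_{A_0B_0\to A_1B_1}$ and every integer $m\ge1$, $e_{\mathrm{NS}}(\Upsilon_m,\mathcal N)$ is finite and $$ \begin{aligned} e_{\mathrm{NS}}(\Upsilon_m,\mathcal N)=\min\ &\ \mu\\ \text{s.t. }&\ Y_{A_0B_0}\le\mu\,\mathbb 1_{A_0B_0},\quad Y\ge0,\quad Y\ge Q-J^{\mathcal N},\quad Q\ge0,\quad Q_{A_0B_0}=\mathbb 1_{A_0B_0},\\ &\ V\ge Q,\quad W\ge Q,\quad X\ge Q,\\ &\ X_{A_0B_0B_1}=\pi_{A_0}\otimes X_{B_0B_1},\quad X_{A_0A_1B_0}=\pi_{B_0}\otimes X_{A_0A_1},\\ &\ mQ_{A_0B_0B_1}=W_{A_0B_0B_1},\quad X_{A_0B_0B_1}=V_{A_0B_0B_1},\\ &\ mQ_{A_0A_1B_0}=V_{A_0A_1B_0},\quad X_{A_0A_1B_0}=W_{A_0A_1B_0}, \end{aligned} $$ where the minimum, which is attained, is over real $\mu$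 and operators $Y,Q,V,W,X$ on $A_0A_1B_0B_1$. -/

import Mathlib

open scoped Matrix Kronecker MatrixOrder ENNReal

noncomputable section

namespace BipartiteSim

/-! A finite-dimensional system with a fixed orthonormal basis indexed by the finite type `a` has
operator space `Op a`; a composite system is indexed by the product of the index types.  The order
`X ≤ Y` between matrices is the Loewner order (`Y - X` is positive semidefinite). -/

/-- The linear operators on the Hilbert space with orthonormal basis indexed by `a`. -/
abbrev Op (a : Type*) := Matrix a a ℂ

/-- Linear maps between operator spaces. -/
abbrev Map (a b : Type*) := Op a →ₗ[ℂ] Op b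

section Channels

variable {a b : Type*}

/-- `F ⊗ id_r`: the map `F` is applied to each of the `r × r` blocks. -/
def ampliate (F : Map a b) (r : Type*) : Map (a × r) (b × r) where
  toFun X := Matrix.of fun p q => F (Matrix.of fun i j => X (i, p.2) (j, q.2)) p.1 q.1
  map_add' X Y := by
    ext p q
    exact congrFun (congrFun (F.map_add (Matrix.of fun i j => X (i, p.2) (j, q.2))
      (Matrix.of fun i j => Y (i, p.2) (j, q.2))) p.1) q.1
  map_smul' c X := by
    ext p q
    exact congrFun (congrFun (F.map_smul c (Matrix.of fun i j => X (i, p.2) (j, q.2))) p.1) q.1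

/-- Complete positivity. -/
def IsCP (F : Map a b) : Prop :=
  ∀ (k : ℕ) (X : Op (a × Fin k)), 0 ≤ X → 0 ≤ ampliate F (Fin k) X

/-- Quantum channels: completely positive, trace-preserving linear maps. -/
structure IsChannel [Fintype a] [Fintype b] (F : Map a b) : Prop where
  cp : IsCP F
  tp : ∀ X : Op a, (F X).trace = X.trace

/-- The trace norm: the sum of the singular values, that is, of the square roots of the
eigenvalues of `Xᴴ X`. -/
def traceNorm [Fintype a] [DecidableEq a] (X : Op a) : ℝ :=
  ∑ i, √((Matrix.isHermitian_conjTranspose_mul_self X).eigenvalues i)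

/-- The diamond norm `sup_k sup_{‖X‖₁ ≤ 1} ‖(F ⊗ id_k) X‖₁`, as an extended nonnegative real. -/
def diamondNorm [Fintype a] [DecidableEq a] [Fintype b] [DecidableEq b] (F : Map a b) : ℝ≥0∞ :=
  ⨆ (k : ℕ) (X : Op (a × Fin k)) (_ : traceNorm X ≤ 1),
    ENNReal.ofReal (traceNorm (ampliate F (Fin k) X))

end Channels

section Replacement

/-- The maximally mixed state `𝟙 / d`. -/
def maxMixed (a : Type*) [Fintype a] [DecidableEq a] : Op a := (Fintype.card a : ℂ)⁻¹ • 1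

variable (a b : Type*) [Fintype a] [DecidableEq a] [Fintype b] [DecidableEq b]

/-- The replacement channel `X ↦ π_a ⊗ tr_a X` on the first party's factor of a bipartite system. -/
def replaceA : Map (a × b) (a × b) where
  toFun X := maxMixed a ⊗ₖ (Matrix.of fun j j' => ∑ i, X (i, j) (i, j'))
  map_add' X Y := by
    rw [← Matrix.kronecker_add]
    congr 1
    ext j j'
    simp [Finset.sum_add_distrib]
  map_smul' c X := by
    rw [RingHom.id_apply, ← Matrix.kronecker_smul]
    congr 1
    ext j j'
    simp [Finset.mul_sum]

/-- The replacement channel `X ↦ tr_b X ⊗ π_b` on the second party's factor. -/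
def replaceB : Map (a × b) (a × b) where
  toFun X := (Matrix.of fun i i' => ∑ j, X (i, j) (i', j)) ⊗ₖ maxMixed b
  map_add' X Y := by
    rw [← Matrix.add_kronecker]
    congr 1
    ext j j'
    simp [Finset.sum_add_distrib]
  map_smul' c X := by
    rw [RingHom.id_apply, ← Matrix.smul_kronecker]
    congr 1
    ext j j'
    simp [Finset.mul_sum]

end Replacement

section Superchannels

/-- Supermaps: linear maps that take maps from `a` to `b` to maps from `c` to `d`. -/
abbrev Supermap (a b c d : Type*) := Map a b →ₗ[ℂ] Map c d

variable {a b c d r₀ r₁ : Type*}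

/-- The component `X ↦ (⟨u| ⊗ id) N(X ⊗ |s⟩⟨t|) (|v⟩ ⊗ id)` of a map `N` with reference systems
`r₀` at the input and `r₁` at the output. -/
def component [DecidableEq r₀] (N : Map (a × r₀) (b × r₁)) (s t : r₀) (u v : r₁) : Map a b where
  toFun X := Matrix.of fun i j => N (X ⊗ₖ Matrix.single s t 1) (i, u) (j, v)
  map_add' X Y := by
    ext i j
    simp [Matrix.add_kronecker]
  map_smul' k X := by
    ext i j
    simp [Matrix.smul_kronecker]

/-- `(Θ ⊗ 𝕀) N`, where `𝕀` is the identity supermap on maps from `r₀` to `r₁`: `Θ` acts on each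
component of `N`.  Thus `(Θ ⊗ 𝕀)(F ⊗ G) = Θ F ⊗ G`. -/
def Supermap.ampliate [Fintype r₀] [DecidableEq r₀] (Θ : Supermap a b c d)
    (N : Map (a × r₀) (b × r₁)) : Map (c × r₀) (d × r₁) where
  toFun Y := Matrix.of fun p q => ∑ s, ∑ t,
    Θ (component N s t p.2 q.2) (Matrix.of fun i j => Y (i, s) (j, t)) p.1 q.1
  map_add' X Y := by
    ext p q
    simp only [Matrix.of_apply, Matrix.add_apply, ← Finset.sum_add_distrib]
    refine Finset.sum_congr rfl fun s _ => Finset.sum_congr rfl fun t _ => ?_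
    exact congrFun (congrFun ((Θ (component N s t p.2 q.2)).map_add
      (Matrix.of fun i j => X (i, s) (j, t)) (Matrix.of fun i j => Y (i, s) (j, t))) p.1) q.1
  map_smul' k X := by
    ext p q
    simp only [Matrix.of_apply, Matrix.smul_apply, RingHom.id_apply, Finset.smul_sum]
    refine Finset.sum_congr rfl fun s _ => Finset.sum_congr rfl fun t _ => ?_
    exact congrFun (congrFun ((Θ (component N s t p.2 q.2)).map_smul k
      (Matrix.of fun i j => X (i, s) (j, t))) p.1) q.1

/-- A superchannel takes channels to channels, also in the presence of arbitrary finite-dimensional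
reference systems. -/
def IsSuperchannel [Fintype a] [Fintype b] [Fintype c] [Fintype d] (Θ : Supermap a b c d) : Prop :=
  ∀ (r₀ r₁ : ℕ) (N : Map (a × Fin r₀) (b × Fin r₁)), IsChannel N → IsChannel (Θ.ampliate N)

end Superchannels

section Bipartite

variable {A₀' B₀' A₁' B₁' A₀ B₀ A₁ B₁ : Type*}
  [Fintype A₀'] [DecidableEq A₀'] [Fintype B₀'] [DecidableEq B₀']
  [Fintype A₁'] [DecidableEq A₁'] [Fintype B₁'] [DecidableEq B₁']
  [Fintype A₀] [DecidableEq A₀] [Fintype B₀] [DecidableEq B₀]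
  [Fintype A₁] [DecidableEq A₁] [Fintype B₁] [DecidableEq B₁]

/-- A non-signalling bipartite superchannel (primed systems belong to the channel that is
transformed).  A replacement channel on an input system acts on maps by composition from the
right, one on an output system by composition from the left; the four conditions are equalities of
supermaps:
`R_{A₀A₁} ∘ Θ ∘ R_{A₀'} = R_{A₁} ∘ Θ ∘ R_{A₀'}`, `R_{A₁} ∘ Θ ∘ R_{A₁'} = R_{A₁} ∘ Θ`, and
the same for the second party. -/
structure IsNSSuperchannel (Θ : Supermap (A₀' × B₀') (A₁' × B₁') (A₀ × B₀) (A₁ × B₁)) : Prop where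
  superchannel : IsSuperchannel Θ
  nsA_input : ∀ N : Map (A₀' × B₀') (A₁' × B₁'),
    replaceA A₁ B₁ ∘ₗ Θ (N ∘ₗ replaceA A₀' B₀') ∘ₗ replaceA A₀ B₀ =
      replaceA A₁ B₁ ∘ₗ Θ (N ∘ₗ replaceA A₀' B₀')
  nsA_output : ∀ N : Map (A₀' × B₀') (A₁' × B₁'),
    replaceA A₁ B₁ ∘ₗ Θ (replaceA A₁' B₁' ∘ₗ N) = replaceA A₁ B₁ ∘ₗ Θ N
  nsB_input : ∀ N : Map (A₀' × B₀') (A₁' × B₁'),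
    replaceB A₁ B₁ ∘ₗ Θ (N ∘ₗ replaceB A₀' B₀') ∘ₗ replaceB A₀ B₀ =
      replaceB A₁ B₁ ∘ₗ Θ (N ∘ₗ replaceB A₀' B₀')
  nsB_output : ∀ N : Map (A₀' × B₀') (A₁' × B₁'),
    replaceB A₁ B₁ ∘ₗ Θ (replaceB A₁' B₁' ∘ₗ N) = replaceB A₁ B₁ ∘ₗ Θ N

/-- The minimum error of simulation from `N` to `M` via non-signalling bipartite superchannels. -/
def simError (N : Map (A₀' × B₀') (A₁' × B₁')) (M : Map (A₀ × B₀) (A₁ × B₁)) : ℝ≥0∞ :=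
  (1 / 2) * ⨅ (Θ : Supermap (A₀' × B₀') (A₁' × B₁') (A₀ × B₀) (A₁ × B₁))
    (_ : IsNSSuperchannel Θ), diamondNorm (Θ N - M)

/-- The bidirectional noiseless classical channel with `m` messages in each direction,
`X ↦ ∑_{k,l} ⟨kl|X|kl⟩ |lk⟩⟨lk|`. -/
def bidirectional (m : ℕ) : Map (Fin m × Fin m) (Fin m × Fin m) where
  toFun X := ∑ k, ∑ l, X (k, l) (k, l) • Matrix.single (l, k) (l, k) 1
  map_add' X Y := by simp only [Matrix.add_apply, add_smul, Finset.sum_add_distrib]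
  map_smul' c X := by
    simp only [Matrix.smul_apply, smul_eq_mul, mul_smul, Finset.smul_sum, RingHom.id_apply]

/-- The Choi-Jamiołkowski operator of a bipartite map, with the systems in the order
`(A₀ A₁) (B₀ B₁)`. -/
def choi (N : Map (A₀ × B₀) (A₁ × B₁)) : Op ((A₀ × A₁) × (B₀ × B₁)) :=
  Matrix.of fun p q =>
    N (Matrix.single (p.1.1, p.2.1) (q.1.1, q.2.1) 1) (p.1.2, p.2.2) (q.1.2, q.2.2)

/-! Marginals of an operator `X` on `A₀ A₁ B₀ B₁`; the name lists the remaining systems. -/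

/-- The marginal on `A₀ B₀`, i.e. `tr_{A₁B₁} X`. -/
def margA₀B₀ (X : Op ((A₀ × A₁) × (B₀ × B₁))) : Op (A₀ × B₀) :=
  Matrix.of fun p q => ∑ x : A₁, ∑ y : B₁, X ((p.1, x), (p.2, y)) ((q.1, x), (q.2, y))

/-- The marginal on `A₀ (B₀ B₁)`, i.e. `tr_{A₁} X`. -/
def margA₀B₀B₁ (X : Op ((A₀ × A₁) × (B₀ × B₁))) : Op (A₀ × (B₀ × B₁)) :=
  Matrix.of fun p q => ∑ x : A₁, X ((p.1, x), p.2) ((q.1, x), q.2)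

/-- The marginal on `B₀ B₁`, i.e. `tr_{A₀A₁} X`. -/
def margB₀B₁ (X : Op ((A₀ × A₁) × (B₀ × B₁))) : Op (B₀ × B₁) :=
  Matrix.of fun p q => ∑ x : A₀ × A₁, X (x, p) (x, q)

/-- The marginal on `(A₀ A₁) B₀`, i.e. `tr_{B₁} X`. -/
def margA₀A₁B₀ (X : Op ((A₀ × A₁) × (B₀ × B₁))) : Op ((A₀ × A₁) × B₀) :=
  Matrix.of fun p q => ∑ y : B₁, X (p.1, (p.2, y)) (q.1, (q.2, y))

/-- The marginal on `A₀ A₁`, i.e. `tr_{B₀B₁} X`. -/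
def margA₀A₁ (X : Op ((A₀ × A₁) × (B₀ × B₁))) : Op (A₀ × A₁) :=
  Matrix.of fun p q => ∑ y : B₀ × B₁, X (p, y) (q, y)

/-- The constraints of the semidefinite program for simulating `N` from `m` messages in each
direction. -/
structure IsFeasible (m : ℕ) (N : Map (A₀ × B₀) (A₁ × B₁)) (μ : ℝ)
    (Y Q V W X : Op ((A₀ × A₁) × (B₀ × B₁))) : Prop where
  Y_marg : margA₀B₀ Y ≤ (μ : ℂ) • 1
  Y_nonneg : 0 ≤ Y
  Y_ge : Q - choi N ≤ Y
  Q_nonneg : 0 ≤ Q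
  Q_marg : margA₀B₀ Q = 1
  V_ge : Q ≤ V
  W_ge : Q ≤ W
  X_ge : Q ≤ X
  X_nsA : margA₀B₀B₁ X = maxMixed A₀ ⊗ₖ margB₀B₁ X
  X_nsB : margA₀A₁B₀ X = margA₀A₁ X ⊗ₖ maxMixed B₀
  QW : (m : ℂ) • margA₀B₀B₁ Q = margA₀B₀B₁ W
  XV : margA₀B₀B₁ X = margA₀B₀B₁ V
  QV : (m : ℂ) • margA₀A₁B₀ Q = margA₀A₁B₀ V
  XW : margA₀A₁B₀ X = margA₀A₁B₀ W

end Bipartite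

end BipartiteSim

end

/-!
The simulation error is matched with the semidefinite program from both sides.

Maps are handled through their Choi operators: a map is a channel iff its Choi operator is positive
with marginal `1` on the input (`isChannel_iff`), and discarding an output system amounts to taking
a marginal of the Choi operator (`replaceA_comp_eq_iff`), so that the non-signalling conditions
become linear constraints on marginals.

The variable `Y` comes from the diamond norm. If `F` is a difference of channels with Choi matrix
`J`, then half its diamond norm is the least `μ` for which there is `Y ≥ 0` with `Y ≥ J` and
marginal at most `μ`. That such a `Y` bounds the norm (`diamondNorm_le`) follows from writing `F` as the
difference of the completely positive maps with Choi matrices `Y` and `Y - J`, and from a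
description of the trace norm of `X` through the positive block matrices with off-diagonal entry
`X`. Conversely (`exists_traceOut_le_of_diamondNorm_le`), if `μ` exceeds half the norm but is not
feasible, a separating hyperplane is a state `σ` on the input, which may be assumed to have full
rank; the output on a purification of `σ` then has a trace norm too large.

The variables `Q`, `V`, `W`, `X` encode the superchannel. A non-signalling superchannel `Θ` gives a
feasible point when it acts on noiseless channels that shift the messages: `Q` is the Choi operator
of `Θ` on the channel without shift, and `V`, `W`, `X` are the sums over all shifts of the message
to the second party, of that to the first, and of both by the same amount
(`IsNSSuperchannel.exists_isCode`). In the opposite direction, a feasible point defines a code that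
sends uniformly random messages and applies a map depending only on which messages arrive
correctly, with Choi operators proportional to `Q`, `V - Q`, `W - Q`, `X - Q` (`codeOp`); the
constraints ensure that this code is a non-signalling superchannel, and it turns the noiseless
channel into the channel with Choi operator `Q`.

Finally the minimum is attained by compactness (`exists_isLeast_feasible`). This is also why the
converse is needed only for values strictly above the error of a given superchannel.
-/

noncomputable section

namespace BipartiteSim

open Matrix
open scoped ComplexOrder

/-- `Matrix.le_iff` with positivity expressed through the order of `Complex` instead of that of
`RCLike`. -/
theorem le_iff_posSemidef_sub {n : Type*} {A B : Op n} : A ≤ B ↔ (B - A).PosSemidef := Iff.rfl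

theorem nonneg_iff {n : Type*} {A : Op n} : 0 ≤ A ↔ A.PosSemidef := nonneg_iff_posSemidef

/-! ### Trace norm and positive block matrices -/

section TraceNorm

variable {a : Type*} [Fintype a] [DecidableEq a]

/-- A singular value decomposition `X = W s Uᴴ` with `U` unitary and `W` a partial isometry that
vanishes on the singular vectors of singular value `0`. -/
theorem exists_singularValueDecomposition (X : Op a) :
    ∃ (W U : Op a) (s : a → ℝ), (∀ i, 0 ≤ s i) ∧ traceNorm X = ∑ i, s i ∧ Uᴴ * U = 1 ∧
      U * Uᴴ = 1 ∧ X = W * diagonal (fun i => (s i : ℂ)) * Uᴴ ∧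
      Wᴴ * W = diagonal (fun i => if s i = 0 then 0 else 1) ∧
      W * diagonal (fun i => if s i = 0 then 0 else 1) = W := by
  have hX := isHermitian_conjTranspose_mul_self X
  set U : Op a := (hX.eigenvectorUnitary : Op a) with hU
  have hU1 : Uᴴ * U = 1 := Unitary.coe_star_mul_self hX.eigenvectorUnitary
  have hU2 : U * Uᴴ = 1 := Unitary.coe_mul_star_self hX.eigenvectorUnitary
  set s : a → ℝ := fun i => √(hX.eigenvalues i) with hs
  have hs2 : ∀ i, hX.eigenvalues i = s i * s i := fun i =>
    (Real.mul_self_sqrt (eigenvalues_conjTranspose_mul_self_nonneg X i)).symm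
  have hgram : (X * U)ᴴ * (X * U) = diagonal (fun i => (s i : ℂ) * s i) := by
    have h := hX.conjStarAlgAut_star_eigenvectorUnitary
    rw [Unitary.conjStarAlgAut_star_apply] at h
    rw [conjTranspose_mul, ← mul_assoc, mul_assoc Uᴴ]
    refine h.trans ?_
    congr 1
    funext i
    simp [hs2 i]
  set E : Op a := diagonal (fun i => ((s i)⁻¹ : ℂ)) with hE
  have hEH : Eᴴ = E := by
    simp [hE, diagonal_conjTranspose, Pi.star_def]
  have hpol : X * U * (1 - diagonal (fun i => if s i = 0 then 0 else 1)) = 0 := by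
    have hd : (1 - diagonal (fun i => if s i = 0 then 0 else 1) : Op a) =
        diagonal (fun i => if s i = 0 then 1 else 0) := by
      rw [← diagonal_one, diagonal_sub]
      congr 1
      funext i
      split_ifs <;> simp
    rw [hd, ← conjTranspose_mul_self_eq_zero, conjTranspose_mul, ← mul_assoc, mul_assoc _ᴴ,
      hgram, diagonal_conjTranspose, diagonal_mul_diagonal, diagonal_mul_diagonal,
      diagonal_eq_zero]
    funext i
    by_cases h : s i = 0 <;> simp [h]
  have hpol' : X * U * diagonal (fun i => if s i = 0 then 0 else 1) = X * U := by
    rw [mul_sub, sub_eq_zero, mul_one] at hpol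
    exact hpol.symm
  refine ⟨X * U * E, U, s, fun i => Real.sqrt_nonneg _, rfl, hU1, hU2, ?_, ?_, ?_⟩
  · have : E * diagonal (fun i => (s i : ℂ)) = diagonal (fun i => if s i = 0 then 0 else 1) := by
      rw [hE, diagonal_mul_diagonal]
      congr 1
      funext i
      by_cases h : s i = 0 <;> simp [h]
    rw [mul_assoc (X * U), this, hpol', mul_assoc, hU2, mul_one]
  · rw [conjTranspose_mul, mul_assoc, ← mul_assoc _ᴴ (X * U), hgram, hEH, hE,
      diagonal_mul_diagonal, diagonal_mul_diagonal]
    congr 1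
    funext i
    by_cases h : s i = 0 <;> simp [h]
  · rw [mul_assoc]
    congr 1
    rw [hE, diagonal_mul_diagonal]
    congr 1
    funext i
    by_cases h : s i = 0 <;> simp [h]

theorem traceNorm_le_of_posSemidef_fromBlocks {X P C R : Op a}
    (h : (fromBlocks P X C R).PosSemidef) :
    2 * traceNorm X ≤ P.trace.re + R.trace.re := by
  obtain ⟨W, U, s, -, hs, hU1, hU2, hX, hW, hWe⟩ := exists_singularValueDecomposition X
  have hblk := isHermitian_fromBlocks_iff.1 h.isHermitian
  obtain rfl : Xᴴ = C := hblk.2.1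
  have hP : P.PosSemidef := h.submatrix Sum.inl
  -- Compressing the block matrix to the pairs of singular vectors `(wᵢ, -uᵢ)`.
  have h1 := (h.conjTranspose_mul_mul_same (fromRows W (-U))).trace_nonneg
  have hWX : Wᴴ * X * U = diagonal (fun i => (s i : ℂ)) := by
    have : Wᴴ * X * U = (Wᴴ * W) * diagonal (fun i => (s i : ℂ)) * (Uᴴ * U) := by
      rw [hX]; simp only [mul_assoc]
    rw [this, hU1, hW, diagonal_mul_diagonal, mul_one]
    congr 1
    funext i
    by_cases h : s i = 0 <;> simp [h]
  have hWX' : Uᴴ * Xᴴ * W = diagonal (fun i => (s i : ℂ)) := by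
    have := congrArg conjTranspose hWX
    simpa [conjTranspose_mul, mul_assoc, diagonal_conjTranspose, Pi.star_def] using this
  have h2 : (fromRows W (-U))ᴴ * fromBlocks P X Xᴴ R * fromRows W (-U) =
      Wᴴ * P * W - Wᴴ * X * U - Uᴴ * Xᴴ * W + Uᴴ * R * U := by
    rw [conjTranspose_fromRows_eq_fromCols_conjTranspose, fromCols_mul_fromBlocks,
      fromCols_mul_fromRows]
    simp only [conjTranspose_neg, add_mul, mul_neg, neg_mul]
    abel
  have hproj : ((1 - W * Wᴴ)ᴴ * (P * (1 - W * Wᴴ))).trace = P.trace - (Wᴴ * P * W).trace := by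
    have hid : (1 - W * Wᴴ) * (1 - W * Wᴴ) = 1 - W * Wᴴ := by
      have : W * Wᴴ * (W * Wᴴ) = W * Wᴴ := by
        calc W * Wᴴ * (W * Wᴴ) = W * (Wᴴ * W) * Wᴴ := by simp only [mul_assoc]
          _ = W * Wᴴ := by rw [hW, hWe]
      rw [mul_sub, sub_mul, sub_mul, this]
      simp
    have hself : (1 - W * Wᴴ)ᴴ = 1 - W * Wᴴ := by simp
    rw [hself, trace_mul_comm, mul_assoc, hid, mul_sub, trace_sub, mul_one, ← mul_assoc,
      trace_mul_comm (P * W), mul_assoc]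
  have h3 := (hP.conjTranspose_mul_mul_same (1 - W * Wᴴ)).trace_nonneg
  rw [mul_assoc, hproj] at h3
  have h4 : (Uᴴ * R * U).trace = R.trace := by
    rw [trace_mul_comm, ← mul_assoc, hU2, one_mul]
  rw [h2, trace_add, trace_sub, trace_sub, hWX, hWX', h4, trace_diagonal] at h1
  have h1' := (Complex.le_def.1 h1).1
  have h3' := (Complex.le_def.1 h3).1
  simp only [Complex.zero_re, Complex.add_re, Complex.sub_re, Complex.re_sum,
    Complex.ofReal_re] at h1' h3'
  rw [hs]
  linarith

theorem exists_posSemidef_fromBlocks_traceNorm (X : Op a) :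
    ∃ P R : Op a, (fromBlocks P X Xᴴ R).PosSemidef ∧ P.trace.re = traceNorm X ∧
      R.trace.re = traceNorm X := by
  obtain ⟨W, U, s, hs0, hs, hU1, -, hX, hW, -⟩ := exists_singularValueDecomposition X
  set D : Op a := diagonal (fun i => (s i : ℂ)) with hD
  have hDp : D.PosSemidef := PosSemidef.diagonal fun i => by simpa using hs0 i
  refine ⟨W * D * Wᴴ, U * D * Uᴴ, ?_, ?_, ?_⟩
  · have := hDp.mul_mul_conjTranspose_same (fromRows W U)
    rw [conjTranspose_fromRows_eq_fromCols_conjTranspose, fromRows_mul, fromRows_mul_fromCols,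
      ← hX] at this
    convert this using 2
    conv_lhs => rw [hX]
    simp [conjTranspose_mul, hDp.isHermitian.eq, mul_assoc]
  · rw [trace_mul_comm, ← mul_assoc, hW, hD, diagonal_mul_diagonal, trace_diagonal, hs,
      Complex.re_sum]
    refine Finset.sum_congr rfl fun i _ => ?_
    by_cases h : s i = 0 <;> simp [h]
  · rw [trace_mul_comm, ← mul_assoc, hU1, one_mul, hD, trace_diagonal, hs, Complex.re_sum]
    simp

end TraceNorm

/-! ### Choi matrices -/

section Choi

variable {a b r : Type*}

/-- The sum of all blocks of a positive block matrix is positive. -/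
theorem posSemidef_sum_blocks [Fintype a] [Finite b] {M : Op (a × b)}
    (hM : M.PosSemidef) :
    (of fun p q => ∑ i, ∑ j, M (i, p) (j, q) : Op b).PosSemidef := by
  classical
  have := Fintype.ofFinite b
  have h := hM.conjTranspose_mul_mul_same ((1 : Op b).submatrix Prod.snd id)
  convert h using 1
  ext p q
  simp only [of_apply, mul_apply, conjTranspose_apply, submatrix_apply, id_eq,
    Fintype.sum_prod_type, one_apply, apply_ite star, star_one, star_zero, ite_mul, one_mul,
    zero_mul, mul_ite, mul_one, mul_zero, Finset.sum_ite_eq', Finset.mem_univ, if_true]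
  exact Finset.sum_comm

/-- The pairing `∑ᵢⱼ Aᵢⱼ Bᵢⱼ = tr (A Bᵀ)` of two positive semidefinite matrices is nonnegative. -/
theorem sum_mul_nonneg [Fintype a] {A B : Op a} (hA : A.PosSemidef) (hB : B.PosSemidef) :
    0 ≤ ∑ i, ∑ j, A i j * B i j := by
  have h := (hA.hadamard hB).dotProduct_mulVec_nonneg (fun _ => 1)
  simpa [dotProduct, mulVec, hadamard_apply] using h

/-- The marginal on `a` of an operator on `a × b`, i.e. the partial trace over `b`. -/
def traceOut [Fintype b] (J : Op (a × b)) : Op a := of fun i j => ∑ x, J (i, x) (j, x)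

theorem traceOut_posSemidef [Fintype b] {J : Op (a × b)} (hJ : J.PosSemidef) :
    (traceOut J).PosSemidef := by
  have : traceOut J = ∑ x, J.submatrix (fun i => (i, x)) (fun i => (i, x)) := by
    ext i j
    simp [traceOut, Matrix.sum_apply]
  rw [this]
  exact posSemidef_sum _ fun x _ => hJ.submatrix _

/-- The Choi matrix `∑ᵢⱼ |i⟩⟨j| ⊗ F(|i⟩⟨j|)` of a map between two unstructured systems. -/
def choiMatrix [DecidableEq a] (F : Map a b) : Op (a × b) :=
  of fun p q => F (single p.1 q.1 1) p.2 q.2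

/-- The map with a prescribed Choi matrix. -/
def ofChoi [Fintype a] (J : Op (a × b)) : Map a b where
  toFun X := of fun x y => ∑ i, ∑ j, X i j * J (i, x) (j, y)
  map_add' X Y := by
    ext x y
    simp [add_mul, Finset.sum_add_distrib]
  map_smul' c X := by
    ext x y
    simp [Finset.mul_sum, mul_assoc]

theorem choiMatrix_ofChoi [Fintype a] [DecidableEq a] (J : Op (a × b)) :
    choiMatrix (ofChoi J) = J := by
  ext p q
  simp only [choiMatrix, ofChoi, LinearMap.coe_mk, AddHom.coe_mk, of_apply]
  rw [Finset.sum_eq_single p.1, Finset.sum_eq_single q.1]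
  · simp
  · intro j _ hj
    simp [hj.symm]
  · simp
  · intro i _ hi
    simp [hi.symm]
  · simp

theorem apply_eq_sum_choiMatrix [Fintype a] [DecidableEq a] (F : Map a b) (X : Op a) (x y : b) :
    F X x y = ∑ i, ∑ j, X i j * choiMatrix F (i, x) (j, y) := by
  conv_lhs => rw [matrix_eq_sum_single X]
  simp only [map_sum, Matrix.sum_apply, choiMatrix, of_apply]
  refine Finset.sum_congr rfl fun i _ => Finset.sum_congr rfl fun j _ => ?_
  have : single i j (X i j) = X i j • single i j (1 : ℂ) := by simp
  rw [this, map_smul, Matrix.smul_apply, smul_eq_mul]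

theorem choiMatrix_injective [Fintype a] [DecidableEq a] {F G : Map a b}
    (h : choiMatrix F = choiMatrix G) : F = G := by
  refine LinearMap.ext fun X => ?_
  ext x y
  rw [apply_eq_sum_choiMatrix, apply_eq_sum_choiMatrix, h]

theorem ampliate_apply [Fintype a] [DecidableEq a] (F : Map a b) (X : Op (a × r)) (p q : b × r) :
    ampliate F r X p q =
      ∑ i, ∑ j, X (i, p.2) (j, q.2) * choiMatrix F (i, p.1) (j, q.1) := by
  exact apply_eq_sum_choiMatrix F _ _ _

theorem ampliate_posSemidef [Fintype a] [DecidableEq a] [Finite b] [Finite r] {F : Map a b}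
    (hF : (choiMatrix F).PosSemidef) {X : Op (a × r)} (hX : X.PosSemidef) :
    (ampliate F r X).PosSemidef := by
  have := Fintype.ofFinite b
  have := Fintype.ofFinite r
  have h := posSemidef_sum_blocks ((hX.kronecker hF).submatrix
    (fun p : a × (b × r) => (((p.1, p.2.2), (p.1, p.2.1)) : (a × r) × (a × b))))
  convert h using 1
  ext p q
  rw [ampliate_apply]
  simp

/-- Choi's theorem. -/
theorem isCP_iff_choiMatrix_posSemidef [Fintype a] [DecidableEq a] [Finite b] {F : Map a b} :
    IsCP F ↔ (choiMatrix F).PosSemidef := by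
  refine ⟨fun h => ?_, fun h k X hX =>
    nonneg_iff.2 (ampliate_posSemidef h (nonneg_iff.1 hX))⟩
  -- `v` is the unnormalised maximally entangled vector.
  set e := Fintype.equivFin a
  set v : a × Fin (Fintype.card a) → ℂ := fun p => if e p.1 = p.2 then 1 else 0 with hv
  have h1 := nonneg_iff.1 (h (Fintype.card a) _
    (nonneg_iff.2 (posSemidef_vecMulVec_self_star v)))
  convert h1.submatrix (fun p : a × b => (p.2, e p.1)) using 1
  ext p q
  have hF : (of fun i j => vecMulVec v (star v) (i, e p.1) (j, e q.1) : Op a) =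
      single p.1 q.1 1 := by
    ext i j
    by_cases h1 : i = p.1 <;> by_cases h2 : j = q.1 <;>
      simp [vecMulVec_apply, hv, h1, h2, eq_comm]
  simp only [choiMatrix, of_apply, submatrix_apply, ampliate, LinearMap.coe_mk, AddHom.coe_mk, hF]

theorem trace_apply_eq_sum [Fintype a] [DecidableEq a] [Fintype b] (F : Map a b) (X : Op a) :
    (F X).trace = ∑ i, ∑ j, X i j * traceOut (choiMatrix F) i j := by
  simp only [trace, diag_apply, apply_eq_sum_choiMatrix F X, traceOut, of_apply, Finset.mul_sum]
  rw [Finset.sum_comm]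
  exact Finset.sum_congr rfl fun i _ => Finset.sum_comm

theorem isChannel_iff [Fintype a] [DecidableEq a] [Fintype b] {F : Map a b} :
    IsChannel F ↔ (choiMatrix F).PosSemidef ∧ traceOut (choiMatrix F) = 1 := by
  constructor
  · refine fun h => ⟨isCP_iff_choiMatrix_posSemidef.1 h.cp, ?_⟩
    ext i j
    have := h.tp (single i j 1)
    rw [show traceOut (choiMatrix F) i j = (F (single i j 1)).trace from rfl, this]
    by_cases hij : i = j
    · subst hij; simp
    · simp [hij]
  · rintro ⟨h1, h2⟩
    refine ⟨isCP_iff_choiMatrix_posSemidef.2 h1, fun X => ?_⟩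
    rw [trace_apply_eq_sum, h2]
    simp [one_apply, trace]

end Choi

/-! ### Upper bound on the diamond norm -/

section DiamondUpper

variable {a b r : Type*} [Fintype a] [Fintype b] [Fintype r]

theorem trace_traceOut (X : Op (a × r)) : (traceOut X).trace = X.trace := by
  simp [trace, traceOut, Fintype.sum_prod_type]

variable [DecidableEq a]

theorem ampliate_fromBlocks_posSemidef {F : Map a b} (hF : (choiMatrix F).PosSemidef)
    {A B C D : Op (a × r)} (h : (fromBlocks A B C D).PosSemidef) :
    (fromBlocks (ampliate F r A) (ampliate F r B) (ampliate F r C)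
      (ampliate F r D)).PosSemidef := by
  have h1 := ampliate_posSemidef hF (h.submatrix (Equiv.prodSumDistrib a r r))
  convert h1.submatrix (Equiv.prodSumDistrib b r r).symm using 1
  ext (p | p) (q | q) <;> rfl

theorem trace_ampliate (F : Map a b) (X : Op (a × r)) :
    (ampliate F r X).trace =
      ∑ i, ∑ j, traceOut X i j * traceOut (choiMatrix F) i j := by
  have h : ∀ s, ∑ x, ampliate F r X (x, s) (x, s) =
      ∑ i, ∑ j, X (i, s) (j, s) * traceOut (choiMatrix F) i j := fun s =>
    trace_apply_eq_sum F (of fun i j => X (i, s) (j, s))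
  rw [trace, Fintype.sum_prod_type_right]
  simp only [diag_apply, h, traceOut, of_apply, Finset.sum_mul]
  rw [Finset.sum_comm]
  exact Finset.sum_congr rfl fun i _ => Finset.sum_comm

theorem trace_ampliate_re_le {F : Map a b} {μ : ℝ}
    (hF : ((μ : ℂ) • 1 - traceOut (choiMatrix F)).PosSemidef) {X : Op (a × r)}
    (hX : X.PosSemidef) : (ampliate F r X).trace.re ≤ μ * X.trace.re := by
  have h := (Complex.le_def.1 (sum_mul_nonneg (traceOut_posSemidef hX) hF)).1
  have h2 : ∑ i, ∑ j, traceOut X i j * ((μ : ℂ) • (1 : Op a) - traceOut (choiMatrix F)) i j =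
      μ * X.trace - (ampliate F r X).trace := by
    rw [trace_ampliate, ← trace_traceOut]
    simp only [Matrix.sub_apply, Matrix.smul_apply, mul_sub, Finset.sum_sub_distrib, one_apply,
      smul_eq_mul, mul_ite, mul_one, mul_zero, Finset.sum_ite_eq, Finset.mem_univ, if_true,
      trace, diag_apply, Finset.mul_sum]
    simp only [mul_comm]
  rw [h2] at h
  simpa using h

/-- The weak duality half of the semidefinite program for the diamond norm. Writing `F` as the
difference of the completely positive maps with Choi matrices `Y` and `Y - J`, a positive block
matrix with off-diagonal entry `X` is mapped to one whose off-diagonal entry is the image of `X`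
under `F` itself, if the sign of the off-diagonal is flipped before the second map is applied. -/
theorem traceNorm_ampliate_le [DecidableEq b] [DecidableEq r] {F : Map a b} {Y : Op (a × b)} {μ : ℝ}
    (hY : Y.PosSemidef) (hYF : (Y - choiMatrix F).PosSemidef)
    (hF : traceOut (choiMatrix F) = 0) (hμ : ((μ : ℂ) • 1 - traceOut Y).PosSemidef)
    (X : Op (a × r)) :
    traceNorm (ampliate F r X) ≤ 2 * μ * traceNorm X := by
  obtain ⟨P, R, hPR, hP, hR⟩ := exists_posSemidef_fromBlocks_traceNorm X
  have hP0 : P.PosSemidef := hPR.submatrix Sum.inl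
  have hR0 : R.PosSemidef := hPR.submatrix Sum.inr
  set G := ofChoi Y with hG
  set G' := ofChoi (Y - choiMatrix F) with hG'
  have hGJ : choiMatrix G = Y := choiMatrix_ofChoi Y
  have hGJ' : choiMatrix G' = Y - choiMatrix F := choiMatrix_ofChoi _
  have hdiff : ampliate F r X = ampliate G r X + ampliate G' r (-X) := by
    ext p q
    rw [map_neg, Matrix.add_apply, Matrix.neg_apply]
    simp only [ampliate_apply, hGJ, hGJ', Matrix.sub_apply, mul_sub, Finset.sum_sub_distrib]
    ring
  have hsign : (fromBlocks P (-X) (-Xᴴ) R).PosSemidef := by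
    have := hPR.conjTranspose_mul_mul_same (fromBlocks (1 : Op (a × r)) 0 0 (-1 : Op (a × r)))
    simpa [fromBlocks_conjTranspose, fromBlocks_multiply] using this
  have h1 := ampliate_fromBlocks_posSemidef (hGJ ▸ hY) hPR
  have h2 := ampliate_fromBlocks_posSemidef (hGJ' ▸ hYF) hsign
  have h3 := h1.add h2
  rw [fromBlocks_add, ← hdiff] at h3
  have h4 := traceNorm_le_of_posSemidef_fromBlocks h3
  have hμ' : ((μ : ℂ) • 1 - traceOut (choiMatrix G')).PosSemidef := by
    rw [hGJ']
    convert hμ using 2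
    ext i j
    have := congrFun (congrFun hF i) j
    simp only [traceOut, of_apply, Matrix.sub_apply, Finset.sum_sub_distrib] at this ⊢
    rw [this]
    simp
  have e1 := trace_ampliate_re_le (hGJ ▸ hμ) hP0
  have e2 := trace_ampliate_re_le (hGJ ▸ hμ) hR0
  have e3 := trace_ampliate_re_le hμ' hP0
  have e4 := trace_ampliate_re_le hμ' hR0
  rw [trace_add, trace_add, Complex.add_re, Complex.add_re] at h4
  rw [hP] at e1 e3
  rw [hR] at e2 e4
  linarith

theorem diamondNorm_le [DecidableEq b] {F : Map a b} {Y : Op (a × b)} {μ : ℝ}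
    (hY : Y.PosSemidef) (hYF : (Y - choiMatrix F).PosSemidef)
    (hF : traceOut (choiMatrix F) = 0) (hμ : ((μ : ℂ) • 1 - traceOut Y).PosSemidef)
    (hμ0 : 0 ≤ μ) : diamondNorm F ≤ ENNReal.ofReal (2 * μ) := by
  refine iSup_le fun k => iSup_le fun X => iSup_le fun hX => ENNReal.ofReal_le_ofReal ?_
  calc _ ≤ 2 * μ * traceNorm X := traceNorm_ampliate_le hY hYF hF hμ X
    _ ≤ 2 * μ * 1 := by gcongr
    _ = 2 * μ := mul_one _

end DiamondUpper

/-! ### Strong duality for the diamond norm -/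

section DiamondLower

variable {a b : Type*} [Fintype a] [Fintype b] [DecidableEq b]

theorem trace_kronecker_one_conj (T : Op a) (Y : Op (a × b)) :
    (T ⊗ₖ (1 : Op b) * Y * (T ⊗ₖ (1 : Op b))ᴴ).trace =
      ∑ i, ∑ j, (Tᴴ * T)ᵀ i j * traceOut Y i j := by
  rw [trace_mul_comm, ← mul_assoc, conjTranspose_kronecker, ← mul_kronecker_mul,
    conjTranspose_one, mul_one, trace]
  simp only [diag_apply, mul_apply (M := _ ⊗ₖ _), Fintype.sum_prod_type, kronecker_apply,
    one_apply, mul_ite, mul_one, mul_zero, ite_mul, zero_mul, Finset.sum_ite_eq,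
    Finset.mem_univ, if_true, traceOut, of_apply, transpose_apply, Finset.mul_sum]
  exact (Finset.sum_congr rfl fun i _ => Finset.sum_comm).trans Finset.sum_comm

variable [DecidableEq a]

/-- For a weight `σ` of full rank, the optimal value of the minimisation of
`tr (σᵀ · traceOut Y)` over `Y ≥ 0`, `Y ≥ J` is at most half the trace norm of the image of
a pure state whose marginal is `σ`, and hence at most `ν`. -/
theorem exists_weighted_le {F : Map a b} (hJ : (choiMatrix F).IsHermitian)
    (h0 : traceOut (choiMatrix F) = 0) {ν : ℝ}
    (hD : ∀ X : Op (a × Fin (Fintype.card a)), traceNorm X ≤ 1 →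
      traceNorm (ampliate F (Fin (Fintype.card a)) X) ≤ 2 * ν)
    {σ : Op a} (hσ : σ.PosDef) (hσ1 : σ.trace.re = 1) :
    ∃ Y : Op (a × b), Y.PosSemidef ∧ (Y - choiMatrix F).PosSemidef ∧
      (∑ i, ∑ j, σ i j * traceOut Y i j).re ≤ ν := by
  obtain ⟨B, hB, rfl⟩ :=
    CStarAlgebra.isStrictlyPositive_iff_eq_star_mul_self.1 (isStrictlyPositive_iff_posDef.2 hσ)
  rw [star_eq_conjTranspose] at *
  set J := choiMatrix F with hJdef
  set e := Fintype.equivFin a with he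
  -- `ψ` is a purification of the weight.
  set ψ : a × Fin (Fintype.card a) → ℂ := fun p => star (B (e.symm p.2) p.1) with hψ
  set X := vecMulVec ψ (star ψ) with hX
  have hXtr : X.trace = (Bᴴ * B).trace := by
    simp only [hX, trace, diag_apply, vecMulVec_apply, Fintype.sum_prod_type, hψ, Pi.star_apply,
      star_star, mul_apply, conjTranspose_apply]
    exact Finset.sum_congr rfl fun i _ => Equiv.sum_comp e.symm fun s => star (B s i) * B s i
  have hX1 : traceNorm X ≤ 1 := by
    have h : (fromBlocks X X X X).PosSemidef := by
      convert posSemidef_vecMulVec_self_star (Sum.elim ψ ψ) using 1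
      ext (i | i) (j | j) <;> rfl
    have := traceNorm_le_of_posSemidef_fromBlocks h
    rw [hXtr, hσ1] at this
    linarith
  set T : Op a := Bᴴᵀ with hT
  have hTT : (Tᴴ * T)ᵀ = Bᴴ * B := by
    ext i j
    simp [hT, mul_apply, mul_comm]
  set C : Op (a × b) := T ⊗ₖ (1 : Op b) with hC
  obtain ⟨P₀, R₀, hPR₀, hP₀, hR₀⟩ :=
    exists_posSemidef_fromBlocks_traceNorm (ampliate F (Fin (Fintype.card a)) X)
  have hle := hD X hX1
  set g : a × b ≃ b × Fin (Fintype.card a) :=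
    (Equiv.prodComm a b).trans (Equiv.prodCongr (Equiv.refl b) e) with hg
  -- `H` is the image of the pure state `X`, with the systems reordered.
  set H : Op (a × b) := C * J * Cᴴ with hH
  have hHH : Hᴴ = H := by
    rw [hH, conjTranspose_mul, conjTranspose_mul, conjTranspose_conjTranspose, hJ.eq, mul_assoc]
  have hHamp : (ampliate F (Fin (Fintype.card a)) X).submatrix g g = H := by
    ext ⟨s, x⟩ ⟨t, y⟩
    rw [submatrix_apply, ampliate_apply]
    simp [hg, hH, hC, mul_apply, Fintype.sum_prod_type, hX, vecMulVec_apply, hψ, hT,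
      one_apply, Finset.sum_mul, apply_ite (starRingEnd ℂ)]
    rw [Finset.sum_comm]
    refine Finset.sum_congr rfl fun i _ => ?_
    exact Finset.sum_congr rfl fun j _ => by ring
  set P := P₀.submatrix g g with hP
  set R := R₀.submatrix g g with hR
  have hPR : (fromBlocks P H H R).PosSemidef := by
    have := hPR₀.submatrix (Sum.map g g)
    convert this using 1
    have hHamp' : (ampliate F (Fin (Fintype.card a)) X)ᴴ.submatrix g g = H := by
      rw [← conjTranspose_submatrix, hHamp, hHH]
    ext (i | i) (j | j)
    · rfl
    · exact (congrFun (congrFun hHamp i) j).symm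
    · exact (congrFun (congrFun hHamp' i) j).symm
    · rfl
  have hPtr : P.trace = P₀.trace := Equiv.sum_comp g fun i => P₀ i i
  have hRtr : R.trace = R₀.trace := Equiv.sum_comp g fun i => R₀ i i
  have hplus : (P + R + (2 : ℂ) • H).PosSemidef := by
    have := hPR.conjTranspose_mul_mul_same (fromRows (1 : Op (a × b)) (1 : Op (a × b)))
    rw [conjTranspose_fromRows_eq_fromCols_conjTranspose, fromCols_mul_fromBlocks,
      fromCols_mul_fromRows] at this
    convert this using 1
    simp [two_smul]
    abel
  have hminus : (P + R - (2 : ℂ) • H).PosSemidef := by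
    have := hPR.conjTranspose_mul_mul_same (fromRows (1 : Op (a × b)) (-1 : Op (a × b)))
    rw [conjTranspose_fromRows_eq_fromCols_conjTranspose, fromCols_mul_fromBlocks,
      fromCols_mul_fromRows] at this
    convert this using 1
    simp [two_smul]
    abel
  have h4 : (0 : ℂ) ≤ 1 / 4 := by norm_num [Complex.le_def]
  -- An operator above both `0` and `H` whose trace is half the trace norm of `H`.
  set Z : Op (a × b) := (1 / 4 : ℂ) • (P + R + (2 : ℂ) • H) with hZ
  have hZ0 : Z.PosSemidef := hplus.smul h4
  have hZH : (Z - H).PosSemidef := by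
    convert hminus.smul h4 using 1
    rw [hZ]
    module
  have hTdet : IsUnit T.det := by
    rw [hT, det_transpose, det_conjTranspose]
    exact ((isUnit_iff_isUnit_det B).1 hB).star
  set C' : Op (a × b) := T⁻¹ ⊗ₖ (1 : Op b) with hC'
  have hCC' : C * C' = 1 := by
    rw [hC, hC', ← mul_kronecker_mul, mul_nonsing_inv T hTdet, one_mul, one_kronecker_one]
  have hC'C : C' * C = 1 := by
    rw [hC, hC', ← mul_kronecker_mul, nonsing_inv_mul T hTdet, one_mul, one_kronecker_one]
  have hCC'H : C'ᴴ * Cᴴ = 1 := by rw [← conjTranspose_mul, hCC', conjTranspose_one]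
  have hC'CH : Cᴴ * C'ᴴ = 1 := by rw [← conjTranspose_mul, hC'C, conjTranspose_one]
  refine ⟨C' * Z * C'ᴴ, hZ0.mul_mul_conjTranspose_same _, ?_, ?_⟩
  · have hJ' : C' * H * C'ᴴ = J := by
      calc C' * H * C'ᴴ = (C' * C) * J * (Cᴴ * C'ᴴ) := by rw [hH]; simp only [mul_assoc]
        _ = J := by rw [hC'C, hC'CH, one_mul, mul_one]
    have := hZH.mul_mul_conjTranspose_same C'
    rwa [mul_sub, sub_mul, hJ'] at this
  · have hpair : ∑ i, ∑ j, (Bᴴ * B) i j * traceOut (C' * Z * C'ᴴ) i j = Z.trace := by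
      rw [← hTT, ← trace_kronecker_one_conj]
      congr 1
      calc C * (C' * Z * C'ᴴ) * Cᴴ = (C * C') * Z * (C'ᴴ * Cᴴ) := by simp only [mul_assoc]
        _ = Z := by rw [hCC', hCC'H, one_mul, mul_one]
    have hHtr : H.trace = 0 := by
      rw [hH, trace_kronecker_one_conj, h0]
      simp
    rw [hpair, hZ, trace_smul, trace_add, trace_smul, hHtr, trace_add, hPtr, hRtr]
    simp [hP₀, hR₀]
    linarith

end DiamondLower

section HahnBanach

variable {a b : Type*} [Fintype a] [DecidableEq a] [Fintype b] [DecidableEq b]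

open scoped Matrix.Norms.L2Operator in
theorem posSemidef_smul_one_add_of_norm_le {K : Op a} (hK : K.IsHermitian) {ε : ℝ}
    (h : ‖K‖ ≤ ε) : ((ε : ℂ) • 1 + K).PosSemidef := by
  have h1 : -(algebraMap ℝ (Op a) ‖K‖) ≤ K := IsSelfAdjoint.neg_algebraMap_norm_le_self hK
  have h2 : (((ε - ‖K‖ : ℝ) : ℂ) • (1 : Op a)).PosSemidef :=
    PosSemidef.one.smul (by simpa using h)
  have h3 := (le_iff_posSemidef_sub.1 h1).add h2
  convert h3 using 1
  rw [Algebra.algebraMap_eq_smul_one, Complex.ofReal_sub, sub_smul, sub_neg_eq_add]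
  have : (‖K‖ : ℝ) • (1 : Op a) = ((‖K‖ : ℝ) : ℂ) • (1 : Op a) := by
    ext i j
    simp
  rw [this]
  abel

open scoped Matrix.Norms.L2Operator in
theorem exists_posSemidef_smul_one_sub {K : Op a} (hK : K.IsHermitian) :
    ∃ c : ℝ, ((c : ℂ) • 1 - K).PosSemidef :=
  ⟨‖K‖, by
    rw [sub_eq_add_neg]
    exact posSemidef_smul_one_add_of_norm_le hK.neg (norm_neg K).le⟩

open scoped Matrix.Norms.L2Operator in
theorem isOpen_setOf_exists_smul_one_le (T : Op a) :
    IsOpen {Z : Op a | ∃ ε : ℝ, 0 < ε ∧ (Z + Zᴴ - T - (ε : ℂ) • 1).PosSemidef} := by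
  refine Metric.isOpen_iff.2 fun Z ⟨ε, hε, hZ⟩ => ⟨ε / 4, by positivity, fun Z' hZ' => ?_⟩
  refine ⟨ε / 2, by positivity, ?_⟩
  rw [Metric.mem_ball, dist_eq_norm] at hZ'
  have hn : ‖(Z' - Z) + (Z' - Z)ᴴ‖ ≤ ε / 2 := by
    refine (norm_add_le _ _).trans ?_
    rw [l2_opNorm_conjTranspose]
    linarith
  have h := hZ.add (posSemidef_smul_one_add_of_norm_le (isHermitian_add_transpose_self _) hn)
  convert h using 1
  rw [conjTranspose_sub]
  push_cast
  module

/-- The strong duality half of the semidefinite program for the diamond norm: any value `μ`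
exceeding half the diamond norm is feasible. If it were not, a hyperplane would separate `μ • 1`
from the upward closure of the marginals of the operators `Y ≥ 0`, `Y ≥ J`; its normal, perturbed
to have full rank, would contradict `exists_weighted_le`. -/
theorem exists_traceOut_le_of_diamondNorm_le [Nonempty a] {F : Map a b}
    (hJ : (choiMatrix F).IsHermitian) (h0 : traceOut (choiMatrix F) = 0) {ν μ : ℝ} (hν : 0 ≤ ν)
    (hνμ : ν < μ) (hD : diamondNorm F ≤ ENNReal.ofReal (2 * ν)) :
    ∃ Y : Op (a × b), Y.PosSemidef ∧ (Y - choiMatrix F).PosSemidef ∧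
      ((μ : ℂ) • 1 - traceOut Y).PosSemidef := by
  by_contra hcon
  push Not at hcon
  have hD' : ∀ X : Op (a × Fin (Fintype.card a)), traceNorm X ≤ 1 →
      traceNorm (ampliate F (Fin (Fintype.card a)) X) ≤ 2 * ν := fun X hX => by
    have h : ENNReal.ofReal (traceNorm (ampliate F (Fin (Fintype.card a)) X)) ≤ diamondNorm F :=
      le_iSup_of_le (Fintype.card a) (le_iSup_of_le X (le_iSup_of_le hX le_rfl))
    exact (ENNReal.ofReal_le_ofReal_iff (by positivity)).1 (h.trans hD)
  set C : Set (Op (a × b)) := {Y | Y.PosSemidef ∧ (Y - choiMatrix F).PosSemidef} with hC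
  set D : Set (Op a) := ⋃ Y ∈ C, {Z : Op a | ∃ ε : ℝ, 0 < ε ∧
    (Z + Zᴴ - (2 : ℂ) • traceOut Y - (ε : ℂ) • 1).PosSemidef} with hDdef
  have hDopen : IsOpen D :=
    isOpen_biUnion fun Y _ => isOpen_setOf_exists_smul_one_le _
  have hmem : ∀ {Y : Op (a × b)}, Y ∈ C → ∀ {ε : ℝ}, 0 < ε → ∀ {M : Op a},
      (M + Mᴴ).PosSemidef → traceOut Y + (ε : ℂ) • 1 + M ∈ D := by
    intro Y hY ε hε M hM
    simp only [hDdef, Set.mem_iUnion]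
    refine ⟨Y, hY, ε, hε, ?_⟩
    have h1 : ((ε : ℂ) • (1 : Op a)).PosSemidef := PosSemidef.one.smul (by simpa using hε.le)
    convert h1.add hM using 1
    rw [conjTranspose_add, conjTranspose_add, (traceOut_posSemidef hY.1).isHermitian.eq,
      conjTranspose_smul, conjTranspose_one]
    simp only [Complex.star_def, Complex.conj_ofReal]
    module
  have hDconv : Convex ℝ D := by
    intro Z hZ Z' hZ' s t hs ht hst
    simp only [hDdef, Set.mem_iUnion] at hZ hZ' ⊢
    obtain ⟨Y, hY, ε, hε, h⟩ := hZ
    obtain ⟨Y', hY', ε', hε', h'⟩ := hZ'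
    have hs' : (0 : ℂ) ≤ s := by simpa using hs
    have ht' : (0 : ℂ) ≤ t := by simpa using ht
    have hst' : (s : ℂ) + t = 1 := by exact_mod_cast hst
    refine ⟨(s : ℂ) • Y + (t : ℂ) • Y', ⟨(hY.1.smul hs').add (hY'.1.smul ht'), ?_⟩,
      s * ε + t * ε', ?_, ?_⟩
    · convert (hY.2.smul hs').add (hY'.2.smul ht') using 1
      conv_lhs => rw [← one_smul ℂ (choiMatrix F), ← hst']
      module
    · rcases hs.eq_or_lt with rfl | hs0
      · have : t = 1 := by linarith
        subst this
        linarith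
      · have := mul_pos hs0 hε
        have := mul_nonneg ht hε'.le
        linarith
    · convert (h.smul hs').add (h'.smul ht') using 1
      have e1 : traceOut ((s : ℂ) • Y + (t : ℂ) • Y') =
          (s : ℂ) • traceOut Y + (t : ℂ) • traceOut Y' := by
        ext i j
        simp [traceOut, Finset.sum_add_distrib, Finset.mul_sum]
      have e2 : ∀ (s : ℝ) (Z : Op a), s • Z = (s : ℂ) • Z := fun s Z => by
        ext i j
        simp
      rw [e1, e2, e2, conjTranspose_add, conjTranspose_smul, conjTranspose_smul]
      simp only [Complex.star_def, Complex.conj_ofReal]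
      push_cast
      module
  have hnot : (μ : ℂ) • (1 : Op a) ∉ D := by
    intro h
    simp only [hDdef, Set.mem_iUnion] at h
    obtain ⟨Y, hY, ε, hε, h⟩ := h
    refine hcon Y hY.1 hY.2 ?_
    have h1 : ((ε : ℂ) • (1 : Op a)).PosSemidef := PosSemidef.one.smul (by simpa using hε.le)
    have h2 : (0 : ℂ) ≤ 1 / 2 := by norm_num [Complex.le_def]
    convert (h.add h1).smul h2 using 1
    rw [conjTranspose_smul, conjTranspose_one]
    simp only [Complex.star_def, Complex.conj_ofReal]
    module
  obtain ⟨f, hf⟩ := RCLike.geometric_hahn_banach_point_open (𝕜 := ℂ) hDconv hDopen hnot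
  simp only [RCLike.re_eq_complex_re] at hf
  -- The case of uniform weight provides some point of `C`.
  obtain ⟨Y₀, hY₀⟩ : ∃ Y, Y ∈ C := by
    have hc : (0 : ℝ) < Fintype.card a := by exact_mod_cast Fintype.card_pos
    obtain ⟨Y, h1, h2, -⟩ := exists_weighted_le hJ h0 hD'
      (σ := (((Fintype.card a : ℝ)⁻¹ : ℝ) : ℂ) • (1 : Op a))
      (PosDef.one.smul (by simpa using hc)) (by simp [trace_smul])
    exact ⟨Y, h1, h2⟩
  -- The functional `f` pairs operators with a positive matrix `σ` of trace `t`.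
  set t := (f 1).re with ht
  have hfs : ∀ (c : ℝ) (M : Op a), (f ((c : ℂ) • M)).re = c * (f M).re := fun c M => by
    simp
  have hray : ∀ M : Op a, (∀ c : ℝ, 0 ≤ c → ((c : ℂ) • M + ((c : ℂ) • M)ᴴ).PosSemidef) →
      0 ≤ (f M).re := by
    intro M hM
    by_contra! hneg
    set A := (f (traceOut Y₀ + ((1 : ℝ) : ℂ) • 1)).re - (f ((μ : ℂ) • 1)).re with hA
    have h := hf _ (hmem hY₀ one_pos (hM (|A| / -(f M).re) (by
      have := abs_nonneg A
      have : 0 < -(f M).re := by linarith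
      positivity)))
    rw [map_add, Complex.add_re, hfs _ M] at h
    have h2 : |A| / -(f M).re * (f M).re = -|A| := by
      rw [div_neg, neg_mul, div_mul_cancel₀ _ hneg.ne]
    rw [h2] at h
    linarith [le_abs_self A]
  have hpos : ∀ M : Op a, M.PosSemidef → 0 ≤ (f M).re := fun M hM => hray M fun c hc => by
    have : ((c : ℂ) • M).PosSemidef := hM.smul (by simpa using hc)
    exact this.add this.conjTranspose
  have hskew : ∀ K : Op a, Kᴴ = -K → (f K).re = 0 := by
    have aux : ∀ K : Op a, Kᴴ = -K → 0 ≤ (f K).re := fun K hK => hray K fun c _ => by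
      rw [conjTranspose_smul, hK]
      simpa using PosSemidef.zero
    intro K hK
    refine le_antisymm ?_ (aux K hK)
    have := aux (-K) (by rw [conjTranspose_neg, hK])
    rw [map_neg, Complex.neg_re] at this
    linarith
  have hreal : ∀ M : Op a, Mᴴ = M → (f M).im = 0 := fun M hM => by
    have := hskew (Complex.I • M) (by rw [conjTranspose_smul, hM]; simp)
    simpa using this
  set σ : Op a := of fun i j => f (single i j 1) with hσ
  have hfσ : ∀ M : Op a, f M = ∑ i, ∑ j, σ i j * M i j := fun M => by
    conv_lhs => rw [matrix_eq_sum_single M]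
    simp only [map_sum]
    refine Finset.sum_congr rfl fun i _ => Finset.sum_congr rfl fun j _ => ?_
    have : single i j (M i j) = M i j • single i j (1 : ℂ) := by simp
    rw [this, map_smul, smul_eq_mul, mul_comm]
    rfl
  have hσherm : σ.IsHermitian := by
    ext i j
    have e1 := hreal (single i j 1 + single j i 1) (by
      rw [conjTranspose_add, conjTranspose_single, conjTranspose_single, star_one, add_comm])
    have e2 := hskew (single i j 1 - single j i 1) (by
      rw [conjTranspose_sub, conjTranspose_single, conjTranspose_single, star_one, neg_sub])
    simp only [map_add, map_sub, Complex.add_im, Complex.sub_re] at e1 e2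
    simp only [conjTranspose_apply, hσ, of_apply]
    apply Complex.ext
    · simp only [Complex.star_def, Complex.conj_re]; linarith
    · simp only [Complex.star_def, Complex.conj_im]; linarith
  have hσpos : σ.PosSemidef := by
    refine PosSemidef.of_dotProduct_mulVec_nonneg hσherm fun x => ?_
    have hx := posSemidef_vecMulVec_star_self x
    have e : star x ⬝ᵥ σ *ᵥ x = f (vecMulVec (star x) x) := by
      rw [hfσ]
      simp only [dotProduct, mulVec, Finset.mul_sum, vecMulVec_apply]
      exact Finset.sum_congr rfl fun i _ => Finset.sum_congr rfl fun j _ => by ring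
    rw [e]
    exact Complex.le_def.2 ⟨hpos _ hx, (hreal _ hx.isHermitian.eq).symm⟩
  have htpos : 0 < t := by
    obtain ⟨c, hc⟩ := exists_posSemidef_smul_one_sub (traceOut_posSemidef hY₀.1).isHermitian
    have h1 : (((max (c + 1) (μ + 1) - (c + 1) : ℝ) : ℂ) • (1 : Op a)).PosSemidef :=
      PosSemidef.one.smul (by
        rw [Complex.zero_le_real]
        linarith [le_max_left (c + 1) (μ + 1)])
    have h2 := hc.add h1
    have h := hf _ (hmem hY₀ one_pos (h2.add h2.conjTranspose))
    have e : traceOut Y₀ + ((1 : ℝ) : ℂ) • 1 + ((c : ℂ) • 1 - traceOut Y₀ +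
        ((max (c + 1) (μ + 1) - (c + 1) : ℝ) : ℂ) • (1 : Op a)) =
        ((max (c + 1) (μ + 1) : ℝ) : ℂ) • 1 := by
      push_cast
      module
    rw [e, hfs, hfs] at h
    have hlt : μ < max (c + 1) (μ + 1) := lt_of_lt_of_le (by linarith) (le_max_right _ _)
    by_contra! hn
    nlinarith
  have hlow : ∀ Y ∈ C, μ * t ≤ (f (traceOut Y)).re := by
    refine fun Y hY => le_of_forall_pos_le_add fun δ hδ => ?_
    have h := hf _ (hmem hY (div_pos hδ htpos) (M := 0) (by simpa using PosSemidef.zero))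
    rw [add_zero, map_add, Complex.add_re, hfs, hfs, div_mul_cancel₀ _ htpos.ne'] at h
    exact h.le
  set n : ℝ := ((Fintype.card a : ℕ) : ℝ) with hn
  have hn0 : 0 ≤ n := Nat.cast_nonneg _
  have hνn : 0 ≤ ν * n := mul_nonneg hν hn0
  -- The size `δ` of the perturbation of `σ` is such that `ν * δ * n < (μ - ν) * t`.
  set δ : ℝ := (μ - ν) * t / (ν * n + 1) with hδ
  have hδpos : 0 < δ := by
    have : 0 < (μ - ν) * t := mul_pos (by linarith) htpos
    positivity
  have hw : 0 < t + δ * n := by positivity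
  have hδσ : (σ + (δ : ℂ) • 1).PosDef :=
    PosDef.posSemidef_add hσpos (PosDef.one.smul (by simpa using hδpos))
  have hσtr : σ.trace = f 1 := by
    rw [hfσ]
    simp [trace, one_apply]
  obtain ⟨Y, hY1, hY2, hY3⟩ := exists_weighted_le hJ h0 hD'
    (σ := (((t + δ * n)⁻¹ : ℝ) : ℂ) • (σ + (δ : ℂ) • 1))
    (hδσ.smul (by rw [Complex.zero_lt_real]; positivity)) (by
      rw [trace_smul, trace_add, hσtr, trace_smul, trace_one, smul_eq_mul, Complex.re_ofReal_mul,
        Complex.add_re, smul_eq_mul, Complex.re_ofReal_mul, Complex.natCast_re]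
      exact inv_mul_cancel₀ hw.ne')
  have e : ∑ i, ∑ j, ((((t + δ * n)⁻¹ : ℝ) : ℂ) • (σ + (δ : ℂ) • (1 : Op a))) i j *
      traceOut Y i j = (((t + δ * n)⁻¹ : ℝ) : ℂ) *
        (f (traceOut Y) + (δ : ℂ) * (traceOut Y).trace) := by
    rw [hfσ]
    simp only [Matrix.smul_apply, Matrix.add_apply, smul_eq_mul, mul_add, add_mul,
      Finset.sum_add_distrib, one_apply, mul_ite, ite_mul, mul_one, mul_zero, zero_mul,
      Finset.sum_ite_eq, Finset.mem_univ, if_true, trace, diag_apply, Finset.mul_sum, mul_assoc]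
  rw [e, Complex.re_ofReal_mul, Complex.add_re, Complex.re_ofReal_mul, inv_mul_le_iff₀ hw] at hY3
  have h1 := hlow Y ⟨hY1, hY2⟩
  have h2 : 0 ≤ (traceOut Y).trace.re :=
    (Complex.le_def.1 (traceOut_posSemidef hY1).trace_nonneg).1
  have h3 : 0 ≤ δ * (traceOut Y).trace.re := mul_nonneg hδpos.le h2
  have h4 : δ * (ν * n + 1) = (μ - ν) * t := div_mul_cancel₀ _ (by positivity)
  nlinarith

end HahnBanach

/-! ### Marginals of Choi operators and replacement channels -/

section Marginals

variable {A₀ B₀ A₁ B₁ : Type*}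

/-- Reorders the systems `(A₀ A₁) (B₀ B₁)`, in which `choi` lists them, as `(A₀ B₀) (A₁ B₁)`,
input before output. -/
def inOut (A₀ A₁ B₀ B₁ : Type*) : (A₀ × A₁) × (B₀ × B₁) ≃ (A₀ × B₀) × (A₁ × B₁) :=
  Equiv.prodProdProdComm A₀ A₁ B₀ B₁

theorem margA₀B₀_submatrix [Fintype A₁] [Fintype B₁] (J : Op ((A₀ × B₀) × (A₁ × B₁))) :
    margA₀B₀ (J.submatrix (inOut A₀ A₁ B₀ B₁) (inOut A₀ A₁ B₀ B₁)) = traceOut J := by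
  ext p q
  simp only [margA₀B₀, traceOut, of_apply, Fintype.sum_prod_type]
  rfl

theorem margA₀B₀_eq_traceOut [Fintype A₁] [Fintype B₁] (X : Op ((A₀ × A₁) × (B₀ × B₁))) :
    margA₀B₀ X =
      traceOut (X.submatrix (inOut A₀ A₁ B₀ B₁).symm (inOut A₀ A₁ B₀ B₁).symm) := by
  rw [← margA₀B₀_submatrix, submatrix_submatrix]
  simp

/-- `margA₀B₀B₁` as a linear map. -/
def trA₁ [Fintype A₁] : Op ((A₀ × A₁) × (B₀ × B₁)) →ₗ[ℂ] Op (A₀ × (B₀ × B₁)) where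
  toFun := margA₀B₀B₁
  map_add' X Y := by ext; simp [margA₀B₀B₁, Finset.sum_add_distrib]
  map_smul' c X := by ext; simp [margA₀B₀B₁, Finset.mul_sum]

/-- `margA₀A₁B₀` as a linear map. -/
def trB₁ [Fintype B₁] : Op ((A₀ × A₁) × (B₀ × B₁)) →ₗ[ℂ] Op ((A₀ × A₁) × B₀) where
  toFun := margA₀A₁B₀
  map_add' X Y := by ext; simp [margA₀A₁B₀, Finset.sum_add_distrib]
  map_smul' c X := by ext; simp [margA₀A₁B₀, Finset.mul_sum]

theorem maxMixed_kronecker_margB₀B₁ [Fintype A₀] [DecidableEq A₀] [Fintype B₀] [DecidableEq B₀]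
    [Fintype A₁] [Fintype B₁] [DecidableEq B₁] (X : Op ((A₀ × A₁) × (B₀ × B₁))) :
    maxMixed A₀ ⊗ₖ margB₀B₁ X = replaceA A₀ (B₀ × B₁) (trA₁ X) := by
  simp only [replaceA, LinearMap.coe_mk, AddHom.coe_mk]
  congr 1
  ext p q
  simp [margB₀B₁, trA₁, margA₀B₀B₁, Fintype.sum_prod_type]

theorem margA₀A₁_kronecker_maxMixed [Fintype A₀] [DecidableEq A₀] [Fintype B₀] [DecidableEq B₀]
    [Fintype A₁] [Fintype B₁] [DecidableEq A₁] (X : Op ((A₀ × A₁) × (B₀ × B₁))) :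
    margA₀A₁ X ⊗ₖ maxMixed B₀ = replaceB (A₀ × A₁) B₀ (trB₁ X) := by
  simp only [replaceB, LinearMap.coe_mk, AddHom.coe_mk]
  congr 1
  ext p q
  simp [margA₀A₁, trB₁, margA₀A₁B₀, Fintype.sum_prod_type]

/-- `choi` as a linear map. -/
def choiₗ [DecidableEq A₀] [DecidableEq B₀] :
    Map (A₀ × B₀) (A₁ × B₁) →ₗ[ℂ] Op ((A₀ × A₁) × (B₀ × B₁)) where
  toFun := choi
  map_add' _ _ := rfl
  map_smul' _ _ := rfl

theorem choi_eq [DecidableEq A₀] [DecidableEq B₀] (F : Map (A₀ × B₀) (A₁ × B₁)) :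
    choi F = choiₗ F := rfl

theorem choi_eq_submatrix [DecidableEq A₀] [DecidableEq B₀] (F : Map (A₀ × B₀) (A₁ × B₁)) :
    choi F = (choiMatrix F).submatrix (inOut A₀ A₁ B₀ B₁) (inOut A₀ A₁ B₀ B₁) := rfl

theorem choi_posSemidef [Fintype A₀] [Fintype B₀] [Fintype A₁] [Fintype B₁] [DecidableEq A₀]
    [DecidableEq B₀] {F : Map (A₀ × B₀) (A₁ × B₁)} (hF : IsChannel F) :
    (choi F).PosSemidef := by
  rw [choi_eq_submatrix]
  exact (isChannel_iff.1 hF).1.submatrix _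

theorem margA₀B₀_choi [Fintype A₀] [Fintype B₀] [Fintype A₁] [Fintype B₁] [DecidableEq A₀]
    [DecidableEq B₀] {F : Map (A₀ × B₀) (A₁ × B₁)} (hF : IsChannel F) : margA₀B₀ (choi F) = 1 := by
  rw [choi_eq_submatrix, margA₀B₀_submatrix]
  exact (isChannel_iff.1 hF).2

variable [DecidableEq A₀] [DecidableEq B₀]

theorem maxMixed_apply (a : Type*) [Fintype a] [DecidableEq a] (i j : a) :
    maxMixed a i j = if i = j then (Fintype.card a : ℂ)⁻¹ else 0 := by
  simp [maxMixed, one_apply]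

/-- Two maps agree after the first party's output is discarded iff their Choi operators have the
same marginal. -/
theorem replaceA_comp_eq_iff [Fintype A₀] [Fintype B₀] [Fintype A₁] [DecidableEq A₁]
    [Nonempty A₁] {F G : Map (A₀ × B₀) (A₁ × B₁)} :
    replaceA A₁ B₁ ∘ₗ F = replaceA A₁ B₁ ∘ₗ G ↔ trA₁ (choi F) = trA₁ (choi G) := by
  have hc : (Fintype.card A₁ : ℂ)⁻¹ ≠ 0 := by simp
  constructor
  · intro h
    ext ⟨i, j, y⟩ ⟨i', j', y'⟩
    obtain ⟨x⟩ := ‹Nonempty A₁›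
    have h1 := congrFun (congrFun (LinearMap.congr_fun h (single (i, j) (i', j') 1)) (x, y)) (x, y')
    simp only [LinearMap.comp_apply, replaceA, LinearMap.coe_mk, AddHom.coe_mk, kronecker_apply,
      maxMixed_apply, if_true, of_apply] at h1
    exact mul_left_cancel₀ hc h1
  · intro h
    refine choiMatrix_injective ?_
    ext ⟨⟨i, j⟩, x, y⟩ ⟨⟨i', j'⟩, x', y'⟩
    have h1 := congrFun (congrFun h (i, j, y)) (i', j', y')
    simp only [trA₁, LinearMap.coe_mk, AddHom.coe_mk, margA₀B₀B₁, choi, of_apply] at h1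
    simp [choiMatrix, replaceA, h1]

theorem replaceB_comp_eq_iff [Fintype A₀] [Fintype B₀] [Fintype B₁] [DecidableEq B₁]
    [Nonempty B₁] {F G : Map (A₀ × B₀) (A₁ × B₁)} :
    replaceB A₁ B₁ ∘ₗ F = replaceB A₁ B₁ ∘ₗ G ↔ trB₁ (choi F) = trB₁ (choi G) := by
  have hc : (Fintype.card B₁ : ℂ)⁻¹ ≠ 0 := by simp
  constructor
  · intro h
    ext ⟨⟨i, x⟩, j⟩ ⟨⟨i', x'⟩, j'⟩
    obtain ⟨y⟩ := ‹Nonempty B₁›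
    have h1 := congrFun (congrFun (LinearMap.congr_fun h (single (i, j) (i', j') 1)) (x, y)) (x', y)
    simp only [LinearMap.comp_apply, replaceB, LinearMap.coe_mk, AddHom.coe_mk, kronecker_apply,
      maxMixed_apply, if_true, of_apply] at h1
    exact mul_right_cancel₀ hc h1
  · intro h
    refine choiMatrix_injective ?_
    ext ⟨⟨i, j⟩, x, y⟩ ⟨⟨i', j'⟩, x', y'⟩
    have h1 := congrFun (congrFun h ((i, x), j)) ((i', x'), j')
    simp only [trB₁, LinearMap.coe_mk, AddHom.coe_mk, margA₀A₁B₀, choi, of_apply] at h1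
    simp [choiMatrix, replaceB, h1]

theorem replaceA_single [Fintype A₀] (i i' : A₀) (j j' : B₀) :
    replaceA A₀ B₀ (single (i, j) (i', j') 1) =
      ∑ k, maxMixed A₀ i i' • single (k, j) (k, j') 1 := by
  ext ⟨x, y⟩ ⟨x', y'⟩
  simp only [replaceA, LinearMap.coe_mk, AddHom.coe_mk, kronecker_apply, maxMixed_apply, of_apply,
    Matrix.sum_apply, Matrix.smul_apply, single_apply, Prod.mk.injEq, smul_eq_mul]
  by_cases h1 : i = i' <;> by_cases h2 : x = x' <;> by_cases h3 : j = y <;>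
    by_cases h4 : j' = y' <;> simp [h1, h2, h3, h4]
  · refine (Finset.sum_eq_zero fun k _ => if_neg ?_).symm
    rintro ⟨rfl, h⟩
    exact h2 h
  · exact Or.inr (Ne.symm h1)

theorem replaceB_single [Fintype B₀] (i i' : A₀) (j j' : B₀) :
    replaceB A₀ B₀ (single (i, j) (i', j') 1) =
      ∑ k, maxMixed B₀ j j' • single (i, k) (i', k) 1 := by
  ext ⟨x, y⟩ ⟨x', y'⟩
  simp only [replaceB, LinearMap.coe_mk, AddHom.coe_mk, kronecker_apply, maxMixed_apply, of_apply,
    Matrix.sum_apply, Matrix.smul_apply, single_apply, Prod.mk.injEq, smul_eq_mul]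
  by_cases h1 : j = j' <;> by_cases h2 : y = y' <;> by_cases h3 : i = x <;>
    by_cases h4 : i' = x' <;> simp [h1, h2, h3, h4]
  · refine (Finset.sum_eq_zero fun k _ => if_neg ?_).symm
    rintro ⟨rfl, h⟩
    exact h2 h
  · exact Or.inl (Ne.symm h1)

theorem comp_replaceA_single_apply [Fintype A₀] (F : Map (A₀ × B₀) (A₁ × B₁)) (i i' : A₀)
    (j j' : B₀) (q q' : A₁ × B₁) :
    (F ∘ₗ replaceA A₀ B₀) (single (i, j) (i', j') 1) q q' =
      maxMixed A₀ i i' * ∑ k, F (single (k, j) (k, j') 1) q q' := by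
  rw [LinearMap.comp_apply, replaceA_single, map_sum, Matrix.sum_apply, Finset.mul_sum]
  refine Finset.sum_congr rfl fun k _ => ?_
  rw [map_smul, Matrix.smul_apply, smul_eq_mul]

theorem comp_replaceB_single_apply [Fintype B₀] (F : Map (A₀ × B₀) (A₁ × B₁)) (i i' : A₀)
    (j j' : B₀) (q q' : A₁ × B₁) :
    (F ∘ₗ replaceB A₀ B₀) (single (i, j) (i', j') 1) q q' =
      maxMixed B₀ j j' * ∑ k, F (single (i, k) (i', k) 1) q q' := by
  rw [LinearMap.comp_apply, replaceB_single, map_sum, Matrix.sum_apply, Finset.mul_sum]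
  refine Finset.sum_congr rfl fun k _ => ?_
  rw [map_smul, Matrix.smul_apply, smul_eq_mul]

theorem trA₁_choi_comp_replaceA [Fintype A₀] [Fintype A₁] (F : Map (A₀ × B₀) (A₁ × B₁)) :
    trA₁ (choi (F ∘ₗ replaceA A₀ B₀)) = replaceA A₀ (B₀ × B₁) (trA₁ (choi F)) := by
  ext ⟨i, j, y⟩ ⟨i', j', y'⟩
  have h : ∀ x, choi (F ∘ₗ replaceA A₀ B₀) ((i, x), (j, y)) ((i', x), (j', y')) =
      maxMixed A₀ i i' * ∑ k, choi F ((k, x), (j, y)) ((k, x), (j', y')) := fun x =>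
    comp_replaceA_single_apply F i i' j j' (x, y) (x, y')
  simp only [trA₁, margA₀B₀B₁, replaceA, LinearMap.coe_mk, AddHom.coe_mk, kronecker_apply, of_apply]
  refine (Finset.sum_congr rfl fun x _ => h x).trans ?_
  rw [← Finset.mul_sum, Finset.sum_comm]

theorem trB₁_choi_comp_replaceB [Fintype B₀] [Fintype B₁] (F : Map (A₀ × B₀) (A₁ × B₁)) :
    trB₁ (choi (F ∘ₗ replaceB A₀ B₀)) = replaceB (A₀ × A₁) B₀ (trB₁ (choi F)) := by
  ext ⟨⟨i, x⟩, j⟩ ⟨⟨i', x'⟩, j'⟩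
  have h : ∀ y, choi (F ∘ₗ replaceB A₀ B₀) ((i, x), (j, y)) ((i', x'), (j', y)) =
      maxMixed B₀ j j' * ∑ k, choi F ((i, x), (k, y)) ((i', x'), (k, y)) := fun y =>
    comp_replaceB_single_apply F i i' j j' (x, y) (x', y)
  simp only [trB₁, margA₀A₁B₀, replaceB, LinearMap.coe_mk, AddHom.coe_mk, kronecker_apply, of_apply]
  refine (Finset.sum_congr rfl fun y _ => h y).trans ?_
  rw [← Finset.mul_sum, Finset.sum_comm, mul_comm]

end Marginals

/-! ### Superchannels acting on classical channels -/

section Classical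

variable {a b c d : Type*} [Fintype a] [DecidableEq a]

/-- The classical channel that measures its input in the fixed basis and answers the outcome `i`
with the basis state `f i`. -/
def classical [DecidableEq b] (f : a → b) : Map a b :=
  ofChoi (diagonal fun p => if p.2 = f p.1 then 1 else 0)

theorem choiMatrix_classical [DecidableEq b] (f : a → b) :
    choiMatrix (classical f) = diagonal fun p => if p.2 = f p.1 then 1 else 0 :=
  choiMatrix_ofChoi _

theorem isChannel_classical [Fintype b] [DecidableEq b] (f : a → b) : IsChannel (classical f) := by
  rw [isChannel_iff, choiMatrix_classical]
  refine ⟨PosSemidef.diagonal fun p => ?_, ?_⟩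
  · dsimp only
    split_ifs <;> simp
  · ext i j
    by_cases h : i = j <;> simp [traceOut, diagonal_apply, one_apply, h]

theorem classical_apply [DecidableEq b] (f : a → b) (X : Op a) :
    classical f X = ∑ i, X i i • single (f i) (f i) 1 := by
  ext x y
  simp only [classical, ofChoi, LinearMap.coe_mk, AddHom.coe_mk, of_apply, diagonal_apply,
    Matrix.sum_apply, Matrix.smul_apply, single_apply, smul_eq_mul, Prod.mk.injEq]
  refine Finset.sum_congr rfl fun i _ => ?_
  rw [Finset.sum_eq_single i (fun j _ hj => by simp [hj.symm]) (by simp)]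
  by_cases h1 : x = y
  · subst h1
    simp [eq_comm]
  · have : ¬(f i = x ∧ f i = y) := fun ⟨h, h'⟩ => h1 (h.symm.trans h')
    simp [h1, this]

theorem bidirectional_eq_classical (m : ℕ) : bidirectional m = classical Prod.swap := by
  refine LinearMap.ext fun X => ?_
  rw [classical_apply, Fintype.sum_prod_type]
  rfl

theorem isChannel_ampliate_fin_one [Fintype c] [DecidableEq c] [Fintype d] {F : Map c d} :
    IsChannel (ampliate F (Fin 1)) ↔ IsChannel F := by
  have h : choiMatrix (ampliate F (Fin 1)) =
      (choiMatrix F).submatrix (fun p => (p.1.1, p.2.1)) (fun p => (p.1.1, p.2.1)) := by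
    ext ⟨⟨i, s⟩, x, u⟩ ⟨⟨j, t⟩, y, v⟩
    obtain rfl := Subsingleton.elim s u
    obtain rfl := Subsingleton.elim t v
    have : (of fun i' j' => single (i, s) (j, t) 1 (i', s) (j', t) : Op c) = single i j 1 := by
      ext i' j'
      simp [single_apply]
    simp only [choiMatrix, ampliate, LinearMap.coe_mk, AddHom.coe_mk, of_apply, submatrix_apply,
      this]
  rw [isChannel_iff, isChannel_iff, h]
  refine and_congr
    ⟨fun h => h.submatrix fun p : c × d => ((p.1, (0 : Fin 1)), (p.2, (0 : Fin 1))),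
      fun h => h.submatrix _⟩
    ⟨fun h => ?_, fun h => ?_⟩
  · ext i j
    have := congrFun (congrFun h (i, 0)) (j, 0)
    simpa [traceOut, Fintype.sum_prod_type, one_apply] using this
  · ext ⟨i, s⟩ ⟨j, t⟩
    obtain rfl := Subsingleton.elim s t
    have := congrFun (congrFun h i) j
    simpa [traceOut, Fintype.sum_prod_type, one_apply] using this

/-- A superchannel maps channels to channels: trivial reference systems suffice for this. -/
theorem IsSuperchannel.isChannel [Fintype b] [Fintype c] [DecidableEq c] [Fintype d]
    {Θ : Supermap a b c d} (hΘ : IsSuperchannel Θ) {F : Map a b} (hF : IsChannel F) : IsChannel (Θ F) := by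
  have h := hΘ 1 1 _ (isChannel_ampliate_fin_one.2 hF)
  have e : Θ.ampliate (ampliate F (Fin 1)) = ampliate (Θ F) (Fin 1) := by
    refine LinearMap.ext fun X => ?_
    ext ⟨x, u⟩ ⟨y, v⟩
    have hcomp : ∀ s t u v : Fin 1, component (ampliate F (Fin 1)) s t u v = F := by
      intro s t u v
      obtain rfl := Subsingleton.elim s u
      obtain rfl := Subsingleton.elim t v
      refine LinearMap.ext fun X => ?_
      ext i j
      simp only [component, ampliate, LinearMap.coe_mk, AddHom.coe_mk, of_apply, kronecker_apply,
        single_apply, and_self, if_true, mul_one]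
      rfl
    obtain rfl := Subsingleton.elim u 0
    obtain rfl := Subsingleton.elim v 0
    simp only [Supermap.ampliate, LinearMap.coe_mk, AddHom.coe_mk, of_apply, hcomp,
      Finset.univ_unique, Finset.sum_singleton]
    rfl
  rw [e] at h
  exact isChannel_ampliate_fin_one.1 h

theorem trA₁_choi_classical {A₀ B₀ A₁ B₁ : Type*} [Fintype A₀] [DecidableEq A₀] [Fintype B₀]
    [DecidableEq B₀] [Fintype A₁] [DecidableEq A₁] [DecidableEq B₁] (f : A₀ × B₀ → A₁ × B₁) :
    trA₁ (choi (classical f)) =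
      diagonal fun p : A₀ × (B₀ × B₁) => if p.2.2 = (f (p.1, p.2.1)).2 then 1 else 0 := by
  ext ⟨i, j, y⟩ ⟨i', j', y'⟩
  simp only [trA₁, margA₀B₀B₁, LinearMap.coe_mk, AddHom.coe_mk, of_apply, choi_eq_submatrix,
    choiMatrix_classical, submatrix_apply, diagonal_apply]
  simp only [inOut, Equiv.prodProdProdComm_apply, Prod.mk.injEq, Prod.ext_iff (y := f _)]
  by_cases h1 : i = i' <;> by_cases h2 : j = j' <;> by_cases h3 : y = y' <;>
    simp [h1, h2, h3, ite_and]

theorem trB₁_choi_classical {A₀ B₀ A₁ B₁ : Type*} [Fintype A₀] [DecidableEq A₀] [Fintype B₀]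
    [DecidableEq B₀] [DecidableEq A₁] [Fintype B₁] [DecidableEq B₁] (f : A₀ × B₀ → A₁ × B₁) :
    trB₁ (choi (classical f)) =
      diagonal fun p : (A₀ × A₁) × B₀ => if p.1.2 = (f (p.1.1, p.2)).1 then 1 else 0 := by
  ext ⟨⟨i, x⟩, j⟩ ⟨⟨i', x'⟩, j'⟩
  simp only [trB₁, margA₀A₁B₀, LinearMap.coe_mk, AddHom.coe_mk, of_apply, choi_eq_submatrix,
    choiMatrix_classical, submatrix_apply, diagonal_apply]
  simp only [inOut, Equiv.prodProdProdComm_apply, Prod.mk.injEq, Prod.ext_iff (y := f _)]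
  by_cases h1 : i = i' <;> by_cases h2 : j = j' <;> by_cases h3 : x = x' <;>
    simp [h1, h2, h3, ite_and]

end Classical

/-! ### Non-signalling superchannels yield feasible points -/

section Converse

variable {A₀ B₀ A₁ B₁ : Type*}
  [Fintype A₀] [DecidableEq A₀] [Fintype B₀] [DecidableEq B₀]
  [Fintype A₁] [DecidableEq A₁] [Fintype B₁] [DecidableEq B₁]

/-- The constraints of the semidefinite program that do not involve the channel to be simulated:
they say that `Q` is the Choi operator of a channel that can be implemented with `m` messages in
each direction and non-signalling assistance. -/
structure IsCode (m : ℕ) (Q V W X : Op ((A₀ × A₁) × (B₀ × B₁))) : Prop where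
  Q_nonneg : 0 ≤ Q
  Q_marg : margA₀B₀ Q = 1
  V_ge : Q ≤ V
  W_ge : Q ≤ W
  X_ge : Q ≤ X
  X_nsA : replaceA A₀ (B₀ × B₁) (trA₁ X) = trA₁ X
  X_nsB : replaceB (A₀ × A₁) B₀ (trB₁ X) = trB₁ X
  QW : trA₁ W = (m : ℂ) • trA₁ Q
  XV : trA₁ V = trA₁ X
  QV : trB₁ V = (m : ℂ) • trB₁ Q
  XW : trB₁ W = trB₁ X

theorem isFeasible_iff {m : ℕ} {N : Map (A₀ × B₀) (A₁ × B₁)} {μ : ℝ}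
    {Y Q V W X : Op ((A₀ × A₁) × (B₀ × B₁))} :
    IsFeasible m N μ Y Q V W X ↔
      IsCode m Q V W X ∧ margA₀B₀ Y ≤ (μ : ℂ) • 1 ∧ 0 ≤ Y ∧ Q - choi N ≤ Y := by
  constructor
  · rintro ⟨h1, h2, h3, h4, h5, h6, h7, h8, h9, h10, h11, h12, h13, h14⟩
    rw [maxMixed_kronecker_margB₀B₁] at h9
    rw [margA₀A₁_kronecker_maxMixed] at h10
    exact ⟨⟨h4, h5, h6, h7, h8, h9.symm, h10.symm, h11.symm, h12.symm, h13.symm, h14.symm⟩,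
      h1, h2, h3⟩
  · rintro ⟨⟨h4, h5, h6, h7, h8, h9, h10, h11, h12, h13, h14⟩, h1, h2, h3⟩
    rw [← maxMixed_kronecker_margB₀B₁] at h9
    rw [← margA₀A₁_kronecker_maxMixed] at h10
    exact ⟨h1, h2, h3, h4, h5, h6, h7, h8, h9.symm, h10.symm, h11.symm, h12.symm, h13.symm,
      h14.symm⟩

variable {m : ℕ} [NeZero m]

/-- The classical channel from messages `(k, l)` that delivers `l + s` to the first party and
`k + t` to the second. -/
def shift (s t : Fin m) : Map (Fin m × Fin m) (Fin m × Fin m) :=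
  classical fun p => (p.2 + s, p.1 + t)

theorem replaceA_comp_shift (s s' t : Fin m) :
    replaceA (Fin m) (Fin m) ∘ₗ shift s t = replaceA (Fin m) (Fin m) ∘ₗ shift s' t := by
  rw [replaceA_comp_eq_iff, shift, shift, trA₁_choi_classical, trA₁_choi_classical]

theorem replaceB_comp_shift (s t t' : Fin m) :
    replaceB (Fin m) (Fin m) ∘ₗ shift s t = replaceB (Fin m) (Fin m) ∘ₗ shift s t' := by
  rw [replaceB_comp_eq_iff, shift, shift, trB₁_choi_classical, trB₁_choi_classical]

theorem trA₁_choi_sum_shift : trA₁ (choi (∑ s : Fin m, shift s s)) = 1 := by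
  rw [choi_eq, map_sum, map_sum]
  simp only [← choi_eq, shift, trA₁_choi_classical]
  ext ⟨i, j, y⟩ ⟨i', j', y'⟩
  simp only [Matrix.sum_apply, diagonal_apply, one_apply]
  by_cases h : ((i, j, y) : Fin m × Fin m × Fin m) = (i', j', y')
  · simp [h, ← sub_eq_iff_eq_add']
  · simp [h]

theorem replaceA_one {a b : Type*} [Fintype a] [DecidableEq a] [Nonempty a] [Fintype b]
    [DecidableEq b] : replaceA a b 1 = 1 := by
  ext ⟨i, j⟩ ⟨i', j'⟩
  by_cases h : i = i' <;> by_cases h' : j = j' <;>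
    simp [replaceA, maxMixed_apply, one_apply, h, h']

theorem replaceB_one {a b : Type*} [Fintype a] [DecidableEq a] [Nonempty b] [Fintype b]
    [DecidableEq b] : replaceB a b 1 = 1 := by
  ext ⟨i, j⟩ ⟨i', j'⟩
  by_cases h : i = i' <;> by_cases h' : j = j' <;>
    simp [replaceB, maxMixed_apply, one_apply, h, h']

theorem trB₁_choi_sum_shift : trB₁ (choi (∑ s : Fin m, shift s s)) = 1 := by
  rw [choi_eq, map_sum, map_sum]
  simp only [← choi_eq, shift, trB₁_choi_classical]
  ext ⟨⟨i, x⟩, j⟩ ⟨⟨i', x'⟩, j'⟩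
  simp only [Matrix.sum_apply, diagonal_apply, one_apply]
  by_cases h : (((i, x), j) : (Fin m × Fin m) × Fin m) = ((i', x'), j')
  · simp [h, ← sub_eq_iff_eq_add']
  · simp [h]

/-- Averaging over equal shifts in both directions, the message that arrives at the second party
is independent of the one sent, so that the first party's input may be replaced by noise. -/
theorem replaceA_comp_sum_shift_comp_replaceA :
    (replaceA (Fin m) (Fin m) ∘ₗ ∑ s : Fin m, shift s s) ∘ₗ replaceA (Fin m) (Fin m) =
      replaceA (Fin m) (Fin m) ∘ₗ ∑ s : Fin m, shift s s := by
  rw [LinearMap.comp_assoc, replaceA_comp_eq_iff, trA₁_choi_comp_replaceA, trA₁_choi_sum_shift,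
    replaceA_one]

theorem replaceB_comp_sum_shift_comp_replaceB :
    (replaceB (Fin m) (Fin m) ∘ₗ ∑ s : Fin m, shift s s) ∘ₗ replaceB (Fin m) (Fin m) =
      replaceB (Fin m) (Fin m) ∘ₗ ∑ s : Fin m, shift s s := by
  rw [LinearMap.comp_assoc, replaceB_comp_eq_iff, trB₁_choi_comp_replaceB, trB₁_choi_sum_shift,
    replaceB_one]

theorem shift_zero : (shift 0 0 : Map (Fin m × Fin m) (Fin m × Fin m)) = bidirectional m := by
  rw [bidirectional_eq_classical, shift]
  congr 1
  funext p
  simp [Prod.swap]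

/-- The operators `V`, `W` and `X` of the semidefinite program are obtained from a non-signalling
superchannel by letting it act on noiseless channels whose messages are shifted on one side, on
the other, or by the same amount on both, and summing over the shifts. -/
theorem IsNSSuperchannel.exists_isCode [Nonempty A₁] [Nonempty B₁]
    {Θ : Supermap (Fin m × Fin m) (Fin m × Fin m) (A₀ × B₀) (A₁ × B₁)}
    (hΘ : IsNSSuperchannel Θ) :
    ∃ V W X, IsCode m (choi (Θ (bidirectional m))) V W X := by
  have hch : ∀ s t, IsChannel (Θ (shift s t)) := fun s t =>
    hΘ.superchannel.isChannel (isChannel_classical _)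
  have hpos : ∀ s t, 0 ≤ choi (Θ (shift s t)) := fun s t => nonneg_iff.2 (choi_posSemidef (hch s t))
  -- The marginals do not depend on a shift of the output that is traced out.
  have hA : ∀ s s' t, trA₁ (choi (Θ (shift s t))) = trA₁ (choi (Θ (shift s' t))) := by
    intro s s' t
    rw [← replaceA_comp_eq_iff, ← hΘ.nsA_output, ← hΘ.nsA_output (shift s' t),
      replaceA_comp_shift s s' t]
  have hB : ∀ s t t', trB₁ (choi (Θ (shift s t))) = trB₁ (choi (Θ (shift s t'))) := by
    intro s t t'
    rw [← replaceB_comp_eq_iff, ← hΘ.nsB_output, ← hΘ.nsB_output (shift s t'),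
      replaceB_comp_shift s t t']
  have hX : ∑ s, choi (Θ (shift s s)) = choi (Θ (∑ s, shift s s)) := by
    simp only [choi_eq, map_sum]
  refine ⟨∑ s, choi (Θ (shift 0 s)), ∑ s, choi (Θ (shift s 0)), ∑ s, choi (Θ (shift s s)), ?_⟩
  rw [← shift_zero]
  refine ⟨hpos _ _, margA₀B₀_choi (hch _ _), ?_, ?_, ?_, ?_, ?_, ?_, ?_, ?_, ?_⟩
  · exact Finset.single_le_sum (f := fun s => choi (Θ (shift 0 s))) (fun s _ => hpos _ _)
      (Finset.mem_univ 0)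
  · exact Finset.single_le_sum (f := fun s => choi (Θ (shift s 0))) (fun s _ => hpos _ _)
      (Finset.mem_univ 0)
  · exact Finset.single_le_sum (f := fun s => choi (Θ (shift s s))) (fun s _ => hpos _ _)
      (Finset.mem_univ 0)
  · set S : Map (Fin m × Fin m) (Fin m × Fin m) := ∑ s : Fin m, shift s s
    have h1 : trA₁ (choi (Θ S)) = trA₁ (choi (Θ (replaceA (Fin m) (Fin m) ∘ₗ S))) := by
      rw [← replaceA_comp_eq_iff, hΘ.nsA_output]
    have h2 := hΘ.nsA_input (replaceA (Fin m) (Fin m) ∘ₗ S)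
    rw [replaceA_comp_sum_shift_comp_replaceA, replaceA_comp_eq_iff, trA₁_choi_comp_replaceA] at h2
    rw [hX, h1, h2]
  · set S : Map (Fin m × Fin m) (Fin m × Fin m) := ∑ s : Fin m, shift s s
    have h1 : trB₁ (choi (Θ S)) = trB₁ (choi (Θ (replaceB (Fin m) (Fin m) ∘ₗ S))) := by
      rw [← replaceB_comp_eq_iff, hΘ.nsB_output]
    have h2 := hΘ.nsB_input (replaceB (Fin m) (Fin m) ∘ₗ S)
    rw [replaceB_comp_sum_shift_comp_replaceB, replaceB_comp_eq_iff, trB₁_choi_comp_replaceB] at h2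
    rw [hX, h1, h2]
  · rw [map_sum, Finset.sum_congr rfl fun s _ => hA s 0 0]
    simp [Nat.cast_smul_eq_nsmul]
  · rw [map_sum, map_sum]
    exact Finset.sum_congr rfl fun s _ => hA 0 s s
  · rw [map_sum, Finset.sum_congr rfl fun s _ => hB 0 s 0]
    simp [Nat.cast_smul_eq_nsmul]
  · rw [map_sum, map_sum]
    exact Finset.sum_congr rfl fun s _ => hB s 0 s

end Converse

/-! ### Superchannels assembled from classical codes -/

section MeasurePrepare

variable {a b c d : Type*} [DecidableEq c]

theorem choiMatrix_ampliate_apply {r₀ r₁ : Type*} [Fintype r₀] [DecidableEq r₀]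
    (Θ : Supermap a b c d) (N : Map (a × r₀) (b × r₁)) (i j : c) (s t : r₀) (x y : d)
    (u v : r₁) :
    choiMatrix (Θ.ampliate N) ((i, s), (x, u)) ((j, t), (y, v)) =
      choiMatrix (Θ (component N s t u v)) (i, x) (j, y) := by
  simp only [choiMatrix, Supermap.ampliate, LinearMap.coe_mk, AddHom.coe_mk, of_apply]
  have h : ∀ s' t', (of fun i' j' => single (i, s) (j, t) 1 (i', s') (j', t') : Op c) =
      if s = s' ∧ t = t' then single i j 1 else 0 := by
    intro s' t'
    ext i' j'
    by_cases h1 : s = s' <;> by_cases h2 : t = t' <;> simp [single_apply, h1, h2]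
  simp only [h]
  rw [Finset.sum_eq_single s (fun s' _ hs => Finset.sum_eq_zero fun t' _ => by simp [hs.symm])
    (by simp), Finset.sum_eq_single t (fun t' _ ht => by simp [ht.symm]) (by simp)]
  simp

variable [Fintype a] [DecidableEq a] [Fintype b] [Fintype c]

/-- The supermap that sends a basis state `p` through the map `M` to be transformed, measures the
output in the basis, and applies to the main system the completely positive map with Choi matrix
`J p q` if the outcome is `q`. -/
def codeSupermap (J : a → b → Op (c × d)) : Supermap a b c d where
  toFun M := ofChoi (∑ p, ∑ q, M (single p p 1) q q • J p q)
  map_add' M M' := by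
    refine choiMatrix_injective ?_
    rw [choiMatrix_ofChoi]
    have : ∀ F G : Map c d, choiMatrix (F + G) = choiMatrix F + choiMatrix G := fun _ _ => rfl
    rw [this, choiMatrix_ofChoi, choiMatrix_ofChoi]
    simp only [LinearMap.add_apply, Matrix.add_apply, add_smul, Finset.sum_add_distrib]
  map_smul' k M := by
    refine choiMatrix_injective ?_
    rw [choiMatrix_ofChoi]
    have : ∀ F : Map c d, choiMatrix (k • F) = k • choiMatrix F := fun _ => rfl
    rw [RingHom.id_apply, this, choiMatrix_ofChoi]
    simp only [LinearMap.smul_apply, Matrix.smul_apply, smul_assoc, Finset.smul_sum]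

theorem choiMatrix_codeSupermap (J : a → b → Op (c × d)) (M : Map a b) :
    choiMatrix (codeSupermap J M) = ∑ p, ∑ q, M (single p p 1) q q • J p q :=
  choiMatrix_ofChoi _

/-- The Choi matrix of `N` transformed by a code, also in the presence of reference systems, is a
sum of tensor products of blocks of the Choi matrix of `N` with the operators `J p q`; hence positivity.
The trace is preserved if the marginals of the `J p q` on the input are equal and add up to `1` when
summed over the messages sent. -/
theorem isSuperchannel_codeSupermap [Fintype d] {J : a → b → Op (c × d)}
    (hJ : ∀ p q, (J p q).PosSemidef) {k : ℂ} (hk : Fintype.card a * k = 1)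
    (hJk : ∀ p q, traceOut (J p q) = k • 1) :
    IsSuperchannel (codeSupermap J) := by
  intro r₀ r₁ N hN
  have hN := isChannel_iff.1 hN
  have hentry : ∀ (i j : c) (s t : Fin r₀) (x y : d) (u v : Fin r₁),
      choiMatrix ((codeSupermap J).ampliate N) ((i, s), (x, u)) ((j, t), (y, v)) =
      ∑ p, ∑ q, choiMatrix N ((p, s), (q, u)) ((p, t), (q, v)) * J p q (i, x) (j, y) := by
    intro i j s t x y u v
    rw [choiMatrix_ampliate_apply, choiMatrix_codeSupermap]
    simp only [Matrix.sum_apply, Matrix.smul_apply, smul_eq_mul]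
    refine Finset.sum_congr rfl fun p _ => Finset.sum_congr rfl fun q _ => ?_
    simp only [component, choiMatrix, LinearMap.coe_mk, AddHom.coe_mk, of_apply]
    rw [single_kronecker_single, mul_one]
  rw [isChannel_iff]
  constructor
  · have : choiMatrix ((codeSupermap J).ampliate N) =
        ∑ p, ∑ q, (choiMatrix N ⊗ₖ J p q).submatrix
          (fun z : (c × Fin r₀) × (d × Fin r₁) => (((p, z.1.2), (q, z.2.2)), (z.1.1, z.2.1)))
          (fun z : (c × Fin r₀) × (d × Fin r₁) =>
            (((p, z.1.2), (q, z.2.2)), (z.1.1, z.2.1))) := by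
      ext ⟨⟨i, s⟩, x, u⟩ ⟨⟨j, t⟩, y, v⟩
      rw [hentry]
      simp only [Matrix.sum_apply, submatrix_apply, kronecker_apply]
    rw [this]
    exact posSemidef_sum _ fun p _ => posSemidef_sum _ fun q _ =>
      (hN.1.kronecker (hJ p q)).submatrix _
  · ext ⟨i, s⟩ ⟨j, t⟩
    have h1 : ∀ p, ∑ q, ∑ u, choiMatrix N ((p, s), (q, u)) ((p, t), (q, u)) =
        if s = t then 1 else 0 := by
      intro p
      have := congrFun (congrFun hN.2 (p, s)) (p, t)
      simpa [traceOut, Fintype.sum_prod_type, one_apply] using this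
    have h2 : ∀ p q, ∑ x, J p q (i, x) (j, x) = k * (1 : Op c) i j := by
      intro p q
      exact congrFun (congrFun (hJk p q) i) j
    calc traceOut (choiMatrix ((codeSupermap J).ampliate N)) (i, s) (j, t)
        = ∑ x, ∑ u, ∑ p, ∑ q,
            choiMatrix N ((p, s), (q, u)) ((p, t), (q, u)) * J p q (i, x) (j, x) := by
          simp only [traceOut, of_apply, Fintype.sum_prod_type, hentry]
      _ = ∑ p, ∑ q, ∑ u, ∑ x,
            choiMatrix N ((p, s), (q, u)) ((p, t), (q, u)) * J p q (i, x) (j, x) := by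
          exact Finset.sum_comm.trans <| (Finset.sum_congr rfl fun u _ => Finset.sum_comm.trans <|
            Finset.sum_congr rfl fun p _ => Finset.sum_comm).trans <| Finset.sum_comm.trans <|
              Finset.sum_congr rfl fun p _ => Finset.sum_comm
      _ = ∑ p : a, (if s = t then 1 else 0) * (k * (1 : Op c) i j) := by
          refine Finset.sum_congr rfl fun p _ => ?_
          rw [← h1 p, Finset.sum_mul]
          refine Finset.sum_congr rfl fun q _ => ?_
          rw [Finset.sum_mul]
          refine Finset.sum_congr rfl fun u _ => ?_
          rw [← Finset.mul_sum, h2]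
      _ = (1 : Op (c × Fin r₀)) (i, s) (j, t) := by
          rw [Finset.sum_const, Finset.card_univ, nsmul_eq_mul, mul_left_comm, ← mul_assoc _ k, hk]
          by_cases h : s = t <;> by_cases h' : i = j <;> simp [one_apply, h, h']

end MeasurePrepare

section BipartiteCode

variable {A₀' B₀' A₁' B₁' A₀ B₀ A₁ B₁ : Type*}
  [Fintype A₀'] [DecidableEq A₀'] [Fintype B₀'] [DecidableEq B₀'] [Fintype A₁'] [Fintype B₁']
  [Fintype A₀] [DecidableEq A₀] [Fintype B₀] [DecidableEq B₀]

/-- `codeSupermap` for Choi operators in the order of systems used by `choi`. -/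
def bipartiteCode (J : A₀' × B₀' → A₁' × B₁' → Op ((A₀ × A₁) × (B₀ × B₁))) :
    Supermap (A₀' × B₀') (A₁' × B₁') (A₀ × B₀) (A₁ × B₁) :=
  codeSupermap fun p q => (J p q).submatrix (inOut A₀ A₁ B₀ B₁).symm (inOut A₀ A₁ B₀ B₁).symm

theorem choi_bipartiteCode (J : A₀' × B₀' → A₁' × B₁' → Op ((A₀ × A₁) × (B₀ × B₁)))
    (M : Map (A₀' × B₀') (A₁' × B₁')) :
    choi (bipartiteCode J M) = ∑ p, ∑ q, M (single p p 1) q q • J p q := by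
  rw [choi_eq_submatrix, bipartiteCode, choiMatrix_codeSupermap]
  ext p q
  simp [Matrix.sum_apply]

theorem isNSSuperchannel_bipartiteCode [Fintype A₁] [Fintype B₁] [DecidableEq A₁']
    [DecidableEq B₁'] [DecidableEq A₁] [DecidableEq B₁] [Nonempty A₁'] [Nonempty B₁']
    [Nonempty A₁] [Nonempty B₁] {J : A₀' × B₀' → A₁' × B₁' → Op ((A₀ × A₁) × (B₀ × B₁))}
    (hJ : ∀ p q, (J p q).PosSemidef) {k : ℂ} (hk : Fintype.card (A₀' × B₀') * k = 1)
    (hJk : ∀ p q, margA₀B₀ (J p q) = k • 1)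
    (hA : ∀ p x x' y, trA₁ (J p (x, y)) = trA₁ (J p (x', y)))
    (hB : ∀ p x y y', trB₁ (J p (x, y)) = trB₁ (J p (x, y')))
    (hA₀ : ∀ l q, replaceA A₀ (B₀ × B₁) (trA₁ (∑ k, J (k, l) q)) = trA₁ (∑ k, J (k, l) q))
    (hB₀ : ∀ k q, replaceB (A₀ × A₁) B₀ (trB₁ (∑ l, J (k, l) q)) = trB₁ (∑ l, J (k, l) q)) :
    IsNSSuperchannel (bipartiteCode J) where
  superchannel := isSuperchannel_codeSupermap (fun p q => (hJ p q).submatrix _) hk fun p q => by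
    rw [← margA₀B₀_eq_traceOut, hJk]
  nsA_input N := by
    have h : choi (bipartiteCode J (N ∘ₗ replaceA A₀' B₀')) =
        ∑ l, ∑ q, ((Fintype.card A₀' : ℂ)⁻¹ * ∑ i, N (single (i, l) (i, l) 1) q q) •
          ∑ k, J (k, l) q := by
      rw [choi_bipartiteCode, Fintype.sum_prod_type, Finset.sum_comm]
      refine Finset.sum_congr rfl fun l _ => ?_
      rw [Finset.sum_comm]
      refine Finset.sum_congr rfl fun q _ => ?_
      rw [Finset.smul_sum]
      refine Finset.sum_congr rfl fun k _ => ?_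
      rw [comp_replaceA_single_apply, maxMixed_apply, if_pos rfl]
    rw [replaceA_comp_eq_iff, trA₁_choi_comp_replaceA, h]
    simp only [map_sum, map_smul] at hA₀ ⊢
    simp only [hA₀]
  nsB_input N := by
    have h : choi (bipartiteCode J (N ∘ₗ replaceB A₀' B₀')) =
        ∑ k, ∑ q, ((Fintype.card B₀' : ℂ)⁻¹ * ∑ i, N (single (k, i) (k, i) 1) q q) •
          ∑ l, J (k, l) q := by
      rw [choi_bipartiteCode, Fintype.sum_prod_type]
      refine Finset.sum_congr rfl fun k _ => ?_
      rw [Finset.sum_comm]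
      refine Finset.sum_congr rfl fun q _ => ?_
      rw [Finset.smul_sum]
      refine Finset.sum_congr rfl fun l _ => ?_
      rw [comp_replaceB_single_apply, maxMixed_apply, if_pos rfl]
    rw [replaceB_comp_eq_iff, trB₁_choi_comp_replaceB, h]
    simp only [map_sum, map_smul] at hB₀ ⊢
    simp only [hB₀]
  nsA_output N := by
    obtain ⟨x₀⟩ := ‹Nonempty A₁'›
    rw [replaceA_comp_eq_iff, choi_bipartiteCode, choi_bipartiteCode]
    simp only [map_sum, map_smul]
    refine Finset.sum_congr rfl fun p _ => ?_
    rw [Fintype.sum_prod_type_right, Fintype.sum_prod_type_right]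
    refine Finset.sum_congr rfl fun y _ => ?_
    simp only [hA p _ x₀ y, ← Finset.sum_smul]
    congr 1
    simp [replaceA, maxMixed_apply]
  nsB_output N := by
    obtain ⟨y₀⟩ := ‹Nonempty B₁'›
    rw [replaceB_comp_eq_iff, choi_bipartiteCode, choi_bipartiteCode]
    simp only [map_sum, map_smul]
    refine Finset.sum_congr rfl fun p _ => ?_
    rw [Fintype.sum_prod_type, Fintype.sum_prod_type]
    refine Finset.sum_congr rfl fun x _ => ?_
    simp only [hB p x _ y₀, ← Finset.sum_smul]
    congr 1
    simp [replaceB, maxMixed_apply, mul_comm]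

end BipartiteCode

section SymmetricCode

variable {A₀ B₀ A₁ B₁ : Type*}

/-- The Choi operators of the code that belongs to a feasible point, for messages `p = (k, l)` sent
and `q = (x, y)` received by the two parties. They depend only on whether each message arrives
correctly (`x = l` for the first party, `y = k` for the second), and are proportional to `Q` if both
do, to `V - Q` or `W - Q` if only the first or only the second party's does, and to `X - Q` if
neither does. The weights share each kind of event equally among the `m²` messages sent and the
`m - 1` incorrect values of a message received; for `X - Q` a single factor `m - 1` appears since
`X` corresponds to shifting both messages by the same amount. For `m = 1` the last three cases do
not occur, and the division by zero is harmless. -/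
def codeOp (m : ℕ) (Q V W X : Op ((A₀ × A₁) × (B₀ × B₁))) (p q : Fin m × Fin m) :
    Op ((A₀ × A₁) × (B₀ × B₁)) :=
  if q.1 = p.2 then
    if q.2 = p.1 then ((m : ℂ) ^ 2)⁻¹ • Q else ((m : ℂ) ^ 2 * (m - 1))⁻¹ • (V - Q)
  else
    if q.2 = p.1 then ((m : ℂ) ^ 2 * (m - 1))⁻¹ • (W - Q)
    else ((m : ℂ) ^ 2 * (m - 1))⁻¹ • (X - Q)

variable {m : ℕ} {Q V W X : Op ((A₀ × A₁) × (B₀ × B₁))}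

theorem choi_bipartiteCode_codeOp [Fintype A₀] [DecidableEq A₀] [Fintype B₀] [DecidableEq B₀]
    (hm : 1 ≤ m) :
    choi (bipartiteCode (codeOp m Q V W X) (bidirectional m)) = Q := by
  rw [choi_bipartiteCode, bidirectional_eq_classical]
  have h : ∀ p q : Fin m × Fin m, classical Prod.swap (single p p 1) q q =
      if p.swap = q then (1 : ℂ) else 0 := fun p q => by
    rw [classical_apply, Finset.sum_eq_single p (fun i _ hi => by simp [hi.symm]) (by simp)]
    simp [single_apply]
  simp only [h, ite_smul, one_smul, zero_smul, Finset.sum_ite_eq, Finset.mem_univ, if_true]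
  have hm' : (m : ℂ) ≠ 0 := by exact_mod_cast (by omega : m ≠ 0)
  simp only [codeOp, Prod.fst_swap, Prod.snd_swap, if_true, Finset.sum_const, Finset.card_univ,
    Fintype.card_prod, Fintype.card_fin, ← Nat.cast_smul_eq_nsmul ℂ, smul_smul]
  rw [Nat.cast_mul, ← sq, mul_inv_cancel₀ (pow_ne_zero 2 hm'), one_smul]

variable [Fintype A₁] [Fintype B₁]

theorem margA₀B₀_congr_trA₁ {X Y : Op ((A₀ × A₁) × (B₀ × B₁))} (h : trA₁ X = trA₁ Y) :
    margA₀B₀ X = margA₀B₀ Y := by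
  ext ⟨i, j⟩ ⟨i', j'⟩
  simp only [margA₀B₀, of_apply]
  rw [Finset.sum_comm, Finset.sum_comm (f := fun x y => Y ((i, x), (j, y)) ((i', x), (j', y)))]
  exact Finset.sum_congr rfl fun y _ => congrFun (congrFun h (i, (j, y))) (i', (j', y))

theorem margA₀B₀_congr_trB₁ {X Y : Op ((A₀ × A₁) × (B₀ × B₁))} (h : trB₁ X = trB₁ Y) :
    margA₀B₀ X = margA₀B₀ Y := by
  ext ⟨i, j⟩ ⟨i', j'⟩
  simp only [margA₀B₀, of_apply]
  exact Finset.sum_congr rfl fun x _ => congrFun (congrFun h ((i, x), j)) ((i', x), j')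

theorem trace_trA₁ [Fintype A₀] [Fintype B₀] (X : Op ((A₀ × A₁) × (B₀ × B₁))) :
    (trA₁ X).trace = X.trace := by
  simp only [trA₁, margA₀B₀B₁, LinearMap.coe_mk, AddHom.coe_mk, trace, diag_apply, of_apply,
    Fintype.sum_prod_type]
  exact Finset.sum_congr rfl fun i _ =>
    (Finset.sum_congr rfl fun j _ => Finset.sum_comm).trans Finset.sum_comm

theorem trace_trB₁ [Fintype A₀] [Fintype B₀] (X : Op ((A₀ × A₁) × (B₀ × B₁))) :
    (trB₁ X).trace = X.trace := by
  simp only [trB₁, margA₀A₁B₀, LinearMap.coe_mk, AddHom.coe_mk, trace, diag_apply, of_apply,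
    Fintype.sum_prod_type]

variable [Fintype A₀] [DecidableEq A₀] [Fintype B₀] [DecidableEq B₀]


theorem codeOp_posSemidef (hm : 1 ≤ m) (h : IsCode m Q V W X) (p q : Fin m × Fin m) :
    (codeOp m Q V W X p q).PosSemidef := by
  have h1 : (0 : ℂ) ≤ ((m : ℂ) ^ 2)⁻¹ := by
    have : (0 : ℝ) ≤ ((m : ℝ) ^ 2)⁻¹ := by positivity
    have := Complex.zero_le_real.2 this
    push_cast at this
    exact this
  have h2 : (0 : ℂ) ≤ ((m : ℂ) ^ 2 * (m - 1))⁻¹ := by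
    have h3 : (0 : ℝ) ≤ (m : ℝ) - 1 := sub_nonneg.2 (by exact_mod_cast hm)
    have : (0 : ℝ) ≤ ((m : ℝ) ^ 2 * (m - 1))⁻¹ := by positivity
    have := Complex.zero_le_real.2 this
    push_cast at this
    exact this
  unfold codeOp
  split_ifs
  · exact (nonneg_iff.1 h.Q_nonneg).smul h1
  · exact (le_iff_posSemidef_sub.1 h.V_ge).smul h2
  · exact (le_iff_posSemidef_sub.1 h.W_ge).smul h2
  · exact (le_iff_posSemidef_sub.1 h.X_ge).smul h2

/-- Once the first party's output is discarded, the code operator does not depend on the message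
that party received. -/
theorem trA₁_codeOp (h : IsCode m Q V W X) (p q : Fin m × Fin m) :
    trA₁ (codeOp m Q V W X p q) = if q.2 = p.1 then ((m : ℂ) ^ 2)⁻¹ • trA₁ Q
      else ((m : ℂ) ^ 2 * (m - 1))⁻¹ • (trA₁ V - trA₁ Q) := by
  unfold codeOp
  split_ifs with h1 h2 h2
  · rw [map_smul]
  · rw [map_smul, map_sub]
  · have hm : (m : ℂ) - 1 ≠ 0 := by
      rw [sub_ne_zero]
      rintro hm
      obtain rfl : m = 1 := by exact_mod_cast hm
      exact h1 (Subsingleton.elim _ _)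
    rw [map_smul, map_sub, h.QW]
    rw [show (m : ℂ) • trA₁ Q - trA₁ Q = ((m : ℂ) - 1) • trA₁ Q by module, smul_smul, mul_inv,
      inv_mul_cancel_right₀ hm]
  · rw [map_smul, map_sub, h.XV]

theorem trB₁_codeOp (h : IsCode m Q V W X) (p q : Fin m × Fin m) :
    trB₁ (codeOp m Q V W X p q) = if q.1 = p.2 then ((m : ℂ) ^ 2)⁻¹ • trB₁ Q
      else ((m : ℂ) ^ 2 * (m - 1))⁻¹ • (trB₁ W - trB₁ Q) := by
  unfold codeOp
  split_ifs with h1 h2 h2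
  · rw [map_smul]
  · have hm : (m : ℂ) - 1 ≠ 0 := by
      rw [sub_ne_zero]
      rintro hm
      obtain rfl : m = 1 := by exact_mod_cast hm
      exact h2 (Subsingleton.elim _ _)
    rw [map_smul, map_sub, h.QV]
    rw [show (m : ℂ) • trB₁ Q - trB₁ Q = ((m : ℂ) - 1) • trB₁ Q by module, smul_smul, mul_inv,
      inv_mul_cancel_right₀ hm]
  · rw [map_smul, map_sub]
  · rw [map_smul, map_sub, h.XW]

theorem sum_ite_eq_add {M : Type*} [AddCommGroup M] [Module ℂ M] (k : Fin m) (x y : M) :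
    ∑ i, (if k = i then x else y) = x + ((m : ℂ) - 1) • y := by
  have : ∀ i, (if k = i then x else y) = y + if k = i then x - y else 0 := fun i => by
    split_ifs <;> abel
  rw [Finset.sum_congr rfl fun i _ => this i, Finset.sum_add_distrib, Finset.sum_ite_eq]
  simp only [Finset.sum_const, Finset.card_univ, Fintype.card_fin, Finset.mem_univ, if_true,
    ← Nat.cast_smul_eq_nsmul ℂ]
  module

/-- With a single message per direction the constraints force `V = Q`. -/
theorem IsCode.eq_of_eq_one (h : IsCode 1 Q V W X) : V = Q ∧ W = Q := by
  constructor
  · refine sub_eq_zero.1 ((PosSemidef.trace_eq_zero_iff (le_iff_posSemidef_sub.1 h.V_ge)).1 ?_)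
    rw [← trace_trB₁, map_sub, h.QV]
    simp
  · refine sub_eq_zero.1 ((PosSemidef.trace_eq_zero_iff (le_iff_posSemidef_sub.1 h.W_ge)).1 ?_)
    rw [← trace_trA₁, map_sub, h.QW]
    simp

/-- Discarding the first party's output and averaging over the message it sends leaves a multiple of
the marginal of `X`, which is where the no-signalling constraint on `X` enters. -/
theorem trA₁_sum_codeOp (h : IsCode m Q V W X) (l : Fin m) (q : Fin m × Fin m) :
    trA₁ (∑ k, codeOp m Q V W X (k, l) q) = ((m : ℂ) ^ 2)⁻¹ • trA₁ X := by
  rw [map_sum, Finset.sum_congr rfl fun k _ => trA₁_codeOp h (k, l) q]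
  dsimp only
  rw [sum_ite_eq_add, smul_smul, mul_inv, ← h.XV]
  by_cases hm : m = 1
  · subst hm
    rw [h.eq_of_eq_one.1]
    simp
  · have hm' : (m : ℂ) - 1 ≠ 0 := sub_ne_zero.2 (by exact_mod_cast hm)
    rw [mul_comm _ ((m : ℂ) - 1)⁻¹, mul_inv_cancel_left₀ hm']
    module

theorem trB₁_sum_codeOp (h : IsCode m Q V W X) (k : Fin m) (q : Fin m × Fin m) :
    trB₁ (∑ l, codeOp m Q V W X (k, l) q) = ((m : ℂ) ^ 2)⁻¹ • trB₁ X := by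
  rw [map_sum, Finset.sum_congr rfl fun l _ => trB₁_codeOp h (k, l) q]
  dsimp only
  rw [sum_ite_eq_add, smul_smul, mul_inv, ← h.XW]
  by_cases hm : m = 1
  · subst hm
    rw [h.eq_of_eq_one.2]
    simp
  · have hm' : (m : ℂ) - 1 ≠ 0 := sub_ne_zero.2 (by exact_mod_cast hm)
    rw [mul_comm _ ((m : ℂ) - 1)⁻¹, mul_inv_cancel_left₀ hm']
    module

/-- All code operators have the same marginal on the inputs, since no-signalling allows one to
change first one and then the other received message to the correct one. -/
theorem margA₀B₀_codeOp (h : IsCode m Q V W X) (p q : Fin m × Fin m) :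
    margA₀B₀ (codeOp m Q V W X p q) = ((m : ℂ) ^ 2)⁻¹ • 1 := by
  obtain ⟨x, y⟩ := q
  have h1 : trA₁ (codeOp m Q V W X p (x, y)) = trA₁ (codeOp m Q V W X p (p.2, y)) := by
    rw [trA₁_codeOp h, trA₁_codeOp h]
  have h2 : trB₁ (codeOp m Q V W X p (p.2, y)) = trB₁ (codeOp m Q V W X p (p.2, p.1)) := by
    rw [trB₁_codeOp h, trB₁_codeOp h]
  rw [margA₀B₀_congr_trA₁ h1, margA₀B₀_congr_trB₁ h2, ← h.Q_marg]
  ext i j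
  simp [codeOp, margA₀B₀, Finset.mul_sum]

theorem IsCode.isNSSuperchannel [DecidableEq A₁] [DecidableEq B₁] [Nonempty A₁]
    [Nonempty B₁] (hm : 1 ≤ m)
    (h : IsCode m Q V W X) : IsNSSuperchannel (bipartiteCode (codeOp m Q V W X)) := by
  have : NeZero m := ⟨by omega⟩
  have hm' : (m : ℂ) ≠ 0 := by exact_mod_cast (by omega : m ≠ 0)
  refine isNSSuperchannel_bipartiteCode (codeOp_posSemidef hm h) (k := ((m : ℂ) ^ 2)⁻¹) ?_
    (margA₀B₀_codeOp h) ?_ ?_ ?_ ?_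
  · rw [Fintype.card_prod, Fintype.card_fin, Nat.cast_mul, ← sq,
      mul_inv_cancel₀ (pow_ne_zero 2 hm')]
  · intro p x x' y
    rw [trA₁_codeOp h, trA₁_codeOp h]
  · intro p x y y'
    rw [trB₁_codeOp h, trB₁_codeOp h]
  · intro l q
    rw [trA₁_sum_codeOp h, map_smul, h.X_nsA]
  · intro k q
    rw [trB₁_sum_codeOp h, map_smul, h.X_nsB]

end SymmetricCode

/-! ### Attainment of the minimum -/

section Compactness

variable {a : Type*} [Fintype a]

open scoped Matrix.Norms.L2Operator in
theorem isClosed_setOf_posSemidef [DecidableEq a] : IsClosed {M : Op a | M.PosSemidef} := by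
  have h : IsClosed {M : Op a | 0 ≤ M} := isClosed_Ici
  simpa only [nonneg_iff] using h

/-- Entries of a positive operator are bounded by its trace, by the positivity of the `2 × 2`
principal minors. -/
theorem norm_apply_le_of_posSemidef {M : Op a} (hM : M.PosSemidef) (i j : a) :
    ‖M i j‖ ≤ M.trace.re := by
  have hd : ∀ k, 0 ≤ (M k k).re ∧ (M k k).im = 0 := fun k =>
    ⟨(Complex.le_def.1 hM.diag_nonneg).1, ((Complex.le_def.1 (hM.diag_nonneg (i := k))).2).symm⟩
  have hle : ∀ k, (M k k).re ≤ M.trace.re := fun k => by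
    rw [trace, Complex.re_sum]
    exact Finset.single_le_sum (f := fun k => (M k k).re) (fun k _ => (hd k).1)
      (Finset.mem_univ k)
  have h := (hM.submatrix ![i, j]).det_nonneg
  rw [det_fin_two] at h
  simp only [submatrix_apply, cons_val_zero, cons_val_one] at h
  rw [← hM.isHermitian.apply j i] at h
  have h' := (Complex.le_def.1 h).1
  have e : M i j * star (M i j) = ((‖M i j‖ ^ 2 : ℝ) : ℂ) := by
    rw [Complex.star_def, Complex.mul_conj, Complex.normSq_eq_norm_sq]
  rw [e, Complex.sub_re, Complex.mul_re, (hd i).2, Complex.ofReal_re] at h'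
  have h2 : ‖M i j‖ ^ 2 ≤ M.trace.re ^ 2 := by
    have := mul_le_mul (hle i) (hle j) (hd j).1 ((hd i).1.trans (hle i))
    simp only [Complex.zero_re, zero_mul, sub_zero] at h'
    nlinarith
  exact (abs_le_of_sq_le_sq' h2 ((hd i).1.trans (hle i))).2

theorem isCompact_setOf_norm_apply_le (a : Type*) (C : ℝ) :
    IsCompact {M : Op a | ∀ i j, ‖M i j‖ ≤ C} := by
  have h : IsCompact (X := a → a → ℂ) {M | ∀ i j, ‖M i j‖ ≤ C} := by
    convert isCompact_univ_pi (s := fun _ : a => Set.univ.pi fun _ : a =>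
      Metric.closedBall (0 : ℂ) C) fun _ => isCompact_univ_pi fun _ => isCompact_closedBall _ _
      using 1
    ext M
    simp
  exact h

variable {A₀ B₀ A₁ B₁ : Type*}

theorem continuous_margA₀B₀ [Fintype A₁] [Fintype B₁] :
    Continuous (margA₀B₀ : Op ((A₀ × A₁) × (B₀ × B₁)) → Op (A₀ × B₀)) := by
  unfold margA₀B₀
  fun_prop

variable [Fintype A₀] [Fintype B₀] [Fintype A₁] [Fintype B₁]

theorem trace_margA₀B₀ (X : Op ((A₀ × A₁) × (B₀ × B₁))) : (margA₀B₀ X).trace = X.trace := by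
  rw [margA₀B₀_eq_traceOut, trace_traceOut]
  exact (inOut A₀ A₁ B₀ B₁).symm.sum_comp fun i => X i i

variable [DecidableEq A₀] [DecidableEq B₀]

theorem IsFeasible.trace_Y_le {m : ℕ} {N : Map (A₀ × B₀) (A₁ × B₁)} {μ : ℝ}
    {Y Q V W X : Op ((A₀ × A₁) × (B₀ × B₁))} (h : IsFeasible m N μ Y Q V W X) :
    Y.trace.re ≤ μ * Fintype.card (A₀ × B₀) := by
  have := (Complex.le_def.1 (le_iff_posSemidef_sub.1 h.Y_marg).trace_nonneg).1
  rw [trace_sub, trace_smul, trace_one, trace_margA₀B₀, Complex.sub_re, smul_eq_mul,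
    Complex.re_ofReal_mul, Complex.natCast_re, Complex.zero_re] at this
  linarith

theorem IsFeasible.nonneg [Nonempty A₀] [Nonempty B₀] {m : ℕ}
    {N : Map (A₀ × B₀) (A₁ × B₁)} {μ : ℝ} {Y Q V W X : Op ((A₀ × A₁) × (B₀ × B₁))}
    (h : IsFeasible m N μ Y Q V W X) : 0 ≤ μ := by
  have h1 := h.trace_Y_le
  have h2 := (Complex.le_def.1 (nonneg_iff.1 h.Y_nonneg).trace_nonneg).1
  have hd : (0 : ℝ) < Fintype.card (A₀ × B₀) := by exact_mod_cast Fintype.card_pos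
  exact nonneg_of_mul_nonneg_left (h2.trans h1) hd

variable [DecidableEq A₁] [DecidableEq B₁]

/-- The code that outputs the maximally mixed state. -/
theorem isCode_maxMixed [Nonempty A₀] [Nonempty B₀] [Nonempty A₁] [Nonempty B₁] {m : ℕ}
    (hm : 1 ≤ m) :
    ∃ Q V W X : Op ((A₀ × A₁) × (B₀ × B₁)), IsCode m Q V W X := by
  set c : ℂ := ((Fintype.card A₁ : ℂ) * Fintype.card B₁)⁻¹ with hc
  have hc0 : 0 ≤ c := by
    have : (0 : ℝ) ≤ ((Fintype.card A₁ : ℝ) * Fintype.card B₁)⁻¹ := by positivity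
    have := Complex.zero_le_real.2 this
    push_cast at this
    exact this
  have hle : c • (1 : Op ((A₀ × A₁) × (B₀ × B₁))) ≤ (m : ℂ) • c • 1 := by
    rw [le_iff_posSemidef_sub]
    have h : (0 : ℂ) ≤ (m : ℂ) - 1 := by
      rw [sub_nonneg]
      exact_mod_cast hm
    convert (PosSemidef.one (n := (A₀ × A₁) × (B₀ × B₁)) (R := ℂ)).smul (mul_nonneg h hc0) using 1
    module
  have hA : trA₁ (1 : Op ((A₀ × A₁) × (B₀ × B₁))) = (Fintype.card A₁ : ℂ) • 1 := by
    ext ⟨i, j⟩ ⟨i', j'⟩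
    by_cases h : i = i' <;> by_cases h' : j = j' <;> simp [trA₁, margA₀B₀B₁, one_apply, h, h']
  have hB : trB₁ (1 : Op ((A₀ × A₁) × (B₀ × B₁))) = (Fintype.card B₁ : ℂ) • 1 := by
    ext ⟨i, j⟩ ⟨i', j'⟩
    by_cases h : i = i' <;> by_cases h' : j = j' <;> simp [trB₁, margA₀A₁B₀, one_apply, h, h']
  refine ⟨c • 1, (m : ℂ) • c • 1, (m : ℂ) • c • 1, (m : ℂ) • c • 1, nonneg_iff.2
    (PosSemidef.one.smul hc0), ?_, hle, hle, hle, ?_, ?_, ?_, rfl, ?_, rfl⟩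
  · ext ⟨i, j⟩ ⟨i', j'⟩
    by_cases h : i = i' <;> by_cases h' : j = j' <;>
      simp [margA₀B₀, one_apply, h, h', hc]
  · simp only [map_smul, hA, replaceA_one]
  · simp only [map_smul, hB, replaceB_one]
  · simp only [map_smul]
  · simp only [map_smul]

theorem isClosed_setOf_isFeasible (m : ℕ) (N : Map (A₀ × B₀) (A₁ × B₁)) :
    IsClosed {z : ℝ × Op ((A₀ × A₁) × (B₀ × B₁)) × Op ((A₀ × A₁) × (B₀ × B₁)) ×
      Op ((A₀ × A₁) × (B₀ × B₁)) × Op ((A₀ × A₁) × (B₀ × B₁)) × Op ((A₀ × A₁) × (B₀ × B₁)) |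
      IsFeasible m N z.1 z.2.1 z.2.2.1 z.2.2.2.1 z.2.2.2.2.1 z.2.2.2.2.2} := by
  have hA : Continuous (trA₁ : Op ((A₀ × A₁) × (B₀ × B₁)) → Op (A₀ × (B₀ × B₁))) :=
    LinearMap.continuous_of_finiteDimensional trA₁
  have hB : Continuous (trB₁ : Op ((A₀ × A₁) × (B₀ × B₁)) → Op ((A₀ × A₁) × B₀)) :=
    LinearMap.continuous_of_finiteDimensional trB₁
  have hAB : Continuous (margA₀B₀ : Op ((A₀ × A₁) × (B₀ × B₁)) → Op (A₀ × B₀)) :=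
    continuous_margA₀B₀
  have hRA : Continuous (replaceA A₀ (B₀ × B₁)) := LinearMap.continuous_of_finiteDimensional _
  have hRB : Continuous (replaceB (A₀ × A₁) B₀) := LinearMap.continuous_of_finiteDimensional _
  have hiff : ∀ {μ : ℝ} {Y Q V W X : Op ((A₀ × A₁) × (B₀ × B₁))},
      IsFeasible m N μ Y Q V W X ↔ ((((μ : ℂ) • 1 - margA₀B₀ Y).PosSemidef ∧ Y.PosSemidef ∧
        (Y - (Q - choi N)).PosSemidef) ∧ Q.PosSemidef ∧ margA₀B₀ Q = 1) ∧
        ((V - Q).PosSemidef ∧ (W - Q).PosSemidef ∧ (X - Q).PosSemidef) ∧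
        (replaceA A₀ (B₀ × B₁) (trA₁ X) = trA₁ X ∧ replaceB (A₀ × A₁) B₀ (trB₁ X) = trB₁ X) ∧
        (trA₁ W = (m : ℂ) • trA₁ Q ∧ trA₁ V = trA₁ X) ∧ trB₁ V = (m : ℂ) • trB₁ Q ∧
          trB₁ W = trB₁ X := by
    intro μ Y Q V W X
    rw [isFeasible_iff, nonneg_iff]
    constructor
    · rintro ⟨⟨h4, h5, h6, h7, h8, h9, h10, h11, h12, h13, h14⟩, h1, h2, h3⟩
      exact ⟨⟨⟨h1, h2, h3⟩, nonneg_iff.1 h4, h5⟩, ⟨h6, h7, h8⟩, ⟨h9, h10⟩, ⟨h11, h12⟩, h13, h14⟩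
    · rintro ⟨⟨⟨h1, h2, h3⟩, h4, h5⟩, ⟨h6, h7, h8⟩, ⟨h9, h10⟩, ⟨h11, h12⟩, h13, h14⟩
      exact ⟨⟨nonneg_iff.2 h4, h5, h6, h7, h8, h9, h10, h11, h12, h13, h14⟩, h1, h2, h3⟩
  simp only [hiff, Set.ofPred_and]
  refine (((isClosed_setOf_posSemidef.preimage ?_).inter
    ((isClosed_setOf_posSemidef.preimage ?_).inter (isClosed_setOf_posSemidef.preimage ?_))).inter
    ((isClosed_setOf_posSemidef.preimage ?_).inter (isClosed_eq ?_ ?_))).inter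
    (((isClosed_setOf_posSemidef.preimage ?_).inter
      ((isClosed_setOf_posSemidef.preimage ?_).inter
        (isClosed_setOf_posSemidef.preimage ?_))).inter
    (((isClosed_eq ?_ ?_).inter (isClosed_eq ?_ ?_)).inter
      (((isClosed_eq ?_ ?_).inter (isClosed_eq ?_ ?_)).inter
        ((isClosed_eq ?_ ?_).inter (isClosed_eq ?_ ?_))))) <;> fun_prop

/-- The minimum of the semidefinite program is attained, since all operators involved are positive
with traces bounded in terms of `m`, `μ` and the dimensions. -/
theorem exists_isLeast_feasible [Nonempty A₀] [Nonempty B₀] [Nonempty A₁] [Nonempty B₁] {m : ℕ}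
    (hm : 1 ≤ m) {N : Map (A₀ × B₀) (A₁ × B₁)} (hN : IsChannel N) :
    ∃ μ₀, IsLeast {μ : ℝ | ∃ Y Q V W X : Op ((A₀ × A₁) × (B₀ × B₁)),
      IsFeasible m N μ Y Q V W X} μ₀ := by
  obtain ⟨Q₁, V₁, W₁, X₁, h₁⟩ := isCode_maxMixed (A₀ := A₀) (B₀ := B₀) (A₁ := A₁) (B₁ := B₁) hm
  have hfeas₁ : IsFeasible m N 1 Q₁ Q₁ V₁ W₁ X₁ := by
    refine isFeasible_iff.2 ⟨h₁, ?_, h₁.Q_nonneg, ?_⟩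
    · rw [h₁.Q_marg, Complex.ofReal_one, one_smul]
    · rw [le_iff_posSemidef_sub, sub_sub_cancel]
      exact choi_posSemidef hN
  set d : ℝ := ((Fintype.card (A₀ × B₀) : ℕ) : ℝ) with hd
  have hd0 : 0 ≤ d := Nat.cast_nonneg _
  have hm1 : (1 : ℝ) ≤ m := by exact_mod_cast hm
  set K := {M : Op ((A₀ × A₁) × (B₀ × B₁)) | ∀ i j, ‖M i j‖ ≤ m * d} with hK
  have hKc : IsCompact K := isCompact_setOf_norm_apply_le _ _
  have hcpt : IsCompact ((Set.Icc (0 : ℝ) 1 ×ˢ K ×ˢ K ×ˢ K ×ˢ K ×ˢ K) ∩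
      {z | IsFeasible m N z.1 z.2.1 z.2.2.1 z.2.2.2.1 z.2.2.2.2.1 z.2.2.2.2.2}) :=
    (isCompact_Icc.prod (hKc.prod (hKc.prod (hKc.prod (hKc.prod hKc))))).inter_right
      (isClosed_setOf_isFeasible m N)
  have hbound : ∀ {μ : ℝ} {Y Q V W X : Op ((A₀ × A₁) × (B₀ × B₁))}, μ ≤ 1 →
      IsFeasible m N μ Y Q V W X → (μ, Y, Q, V, W, X) ∈
        (Set.Icc (0 : ℝ) 1 ×ˢ K ×ˢ K ×ˢ K ×ˢ K ×ˢ K) ∩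
      {z | IsFeasible m N z.1 z.2.1 z.2.2.1 z.2.2.2.1 z.2.2.2.2.1 z.2.2.2.2.2} := by
    intro μ Y Q V W X hμ h
    have hc := (isFeasible_iff.1 h).1
    have hmem : ∀ {M : Op ((A₀ × A₁) × (B₀ × B₁))}, 0 ≤ M → M.trace.re ≤ m * d → M ∈ K :=
      fun hM hle i j => (norm_apply_le_of_posSemidef (nonneg_iff.1 hM) i j).trans hle
    have hQ : Q.trace = Fintype.card (A₀ × B₀) := by
      rw [← trace_margA₀B₀, hc.Q_marg, trace_one]
    have hV : V.trace = m * Fintype.card (A₀ × B₀) := by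
      rw [← trace_trB₁, hc.QV, trace_smul, trace_trB₁, hQ, smul_eq_mul]
    have hW : W.trace = m * Fintype.card (A₀ × B₀) := by
      rw [← trace_trA₁, hc.QW, trace_smul, trace_trA₁, hQ, smul_eq_mul]
    have hX : X.trace = m * Fintype.card (A₀ × B₀) := by
      rw [← trace_trA₁, ← hc.XV, trace_trA₁, hV]
    refine ⟨⟨⟨h.nonneg, hμ⟩, hmem h.Y_nonneg ?_, hmem hc.Q_nonneg ?_,
      hmem (hc.Q_nonneg.trans hc.V_ge) ?_, hmem (hc.Q_nonneg.trans hc.W_ge) ?_,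
      hmem (hc.Q_nonneg.trans hc.X_ge) ?_⟩, h⟩
    · exact h.trace_Y_le.trans (mul_le_mul_of_nonneg_right (hμ.trans hm1) hd0)
    · rw [hQ, Complex.natCast_re]
      exact le_mul_of_one_le_left hd0 hm1
    · rw [hV]; simp [hd]
    · rw [hW]; simp [hd]
    · rw [hX]; simp [hd]
  obtain ⟨z, hz, hmin⟩ := hcpt.exists_isMinOn ⟨_, hbound le_rfl hfeas₁⟩
    continuous_fst.continuousOn
  -- Values above `1` need not be considered, since `1` is feasible.
  refine ⟨z.1, ⟨_, _, _, _, _, hz.2⟩, ?_⟩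
  rintro μ ⟨Y, Q, V, W, X, h⟩
  rcases le_total μ 1 with hμ | hμ
  · exact hmin (hbound hμ h)
  · exact hz.1.1.2.trans hμ

end Compactness

/-! ### The simulation error as a semidefinite program -/

section Main

variable {A₀ B₀ A₁ B₁ : Type*} [DecidableEq A₀] [DecidableEq B₀]

theorem choiMatrix_eq_submatrix (F : Map (A₀ × B₀) (A₁ × B₁)) :
    choiMatrix F =
      (choi F).submatrix (inOut A₀ A₁ B₀ B₁).symm (inOut A₀ A₁ B₀ B₁).symm := by
  rw [choi_eq_submatrix, submatrix_submatrix]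
  simp

variable [Fintype A₀] [Fintype B₀] [Fintype A₁] [Fintype B₁]

theorem traceOut_choiMatrix_sub {F G : Map (A₀ × B₀) (A₁ × B₁)} (hF : IsChannel F)
    (hG : IsChannel G) : traceOut (choiMatrix (F - G)) = 0 := by
  have : traceOut (choiMatrix (F - G)) = traceOut (choiMatrix F) - traceOut (choiMatrix G) := by
    ext i j
    simp [traceOut, choiMatrix]
  rw [this, (isChannel_iff.1 hF).2, (isChannel_iff.1 hG).2, sub_self]

variable [DecidableEq A₁] [DecidableEq B₁] {m : ℕ} {N : Map (A₀ × B₀) (A₁ × B₁)}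

/-- Achievability: the code of a feasible point simulates `N` with error at most `μ`. -/
theorem IsFeasible.simError_le [Nonempty A₁] [Nonempty B₁] (hm : 1 ≤ m) (hN : IsChannel N)
    {μ : ℝ} (hμ : 0 ≤ μ) {Y Q V W X : Op ((A₀ × A₁) × (B₀ × B₁))}
    (h : IsFeasible m N μ Y Q V W X) :
    simError (bidirectional m) N ≤ ENNReal.ofReal μ := by
  have : NeZero m := ⟨by omega⟩
  obtain ⟨hcode, hY1, hY2, hY3⟩ := isFeasible_iff.1 h
  set Θ := bipartiteCode (codeOp m Q V W X) with hΘ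
  have hNS : IsNSSuperchannel Θ := hcode.isNSSuperchannel hm
  have hQ : choi (Θ (bidirectional m)) = Q := choi_bipartiteCode_codeOp hm
  have hch : IsChannel (Θ (bidirectional m)) := hNS.superchannel.isChannel (by
    rw [bidirectional_eq_classical]
    exact isChannel_classical _)
  have hd : diamondNorm (Θ (bidirectional m) - N) ≤ ENNReal.ofReal (2 * μ) := by
    refine diamondNorm_le ((nonneg_iff.1 hY2).submatrix (inOut A₀ A₁ B₀ B₁).symm) ?_
      (traceOut_choiMatrix_sub hch hN) ?_ hμ
    · rw [choiMatrix_eq_submatrix, choi_eq, map_sub, ← choi_eq, ← choi_eq, hQ]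
      exact (le_iff_posSemidef_sub.1 hY3).submatrix _
    · rw [← margA₀B₀_eq_traceOut]
      exact le_iff_posSemidef_sub.1 hY1
  calc simError (bidirectional m) N
      ≤ 1 / 2 * ENNReal.ofReal (2 * μ) := by
        unfold simError
        gcongr
        exact (iInf₂_le Θ hNS).trans hd
    _ = ENNReal.ofReal μ := by
        rw [ENNReal.ofReal_mul zero_le_two, ← mul_assoc, ENNReal.ofReal_ofNat, one_div,
          ENNReal.inv_mul_cancel two_ne_zero ENNReal.ofNat_ne_top, one_mul]

/-- Converse: a non-signalling superchannel of error `ν` yields a feasible point for every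
`μ > ν`. -/
theorem IsNSSuperchannel.exists_isFeasible [Nonempty A₀] [Nonempty B₀] [Nonempty A₁]
    [Nonempty B₁] (hm : 1 ≤ m) (hN : IsChannel N)
    {Θ : Supermap (Fin m × Fin m) (Fin m × Fin m) (A₀ × B₀) (A₁ × B₁)}
    (hΘ : IsNSSuperchannel Θ) {ν μ : ℝ} (hν : 0 ≤ ν) (hνμ : ν < μ)
    (hd : diamondNorm (Θ (bidirectional m) - N) ≤ ENNReal.ofReal (2 * ν)) :
    ∃ Y Q V W X : Op ((A₀ × A₁) × (B₀ × B₁)), IsFeasible m N μ Y Q V W X := by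
  have : NeZero m := ⟨by omega⟩
  obtain ⟨V, W, X, hcode⟩ := hΘ.exists_isCode
  have hch : IsChannel (Θ (bidirectional m)) := hΘ.superchannel.isChannel (by
    rw [bidirectional_eq_classical]
    exact isChannel_classical _)
  have hherm : (choiMatrix (Θ (bidirectional m) - N)).IsHermitian := by
    have : choiMatrix (Θ (bidirectional m) - N) = choiMatrix (Θ (bidirectional m)) -
      choiMatrix N := rfl
    rw [this]
    exact (isChannel_iff.1 hch).1.isHermitian.sub (isChannel_iff.1 hN).1.isHermitian
  obtain ⟨Y, hY1, hY2, hY3⟩ := exists_traceOut_le_of_diamondNorm_le hherm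
    (traceOut_choiMatrix_sub hch hN) hν hνμ hd
  refine ⟨Y.submatrix (inOut A₀ A₁ B₀ B₁) (inOut A₀ A₁ B₀ B₁), _, V, W, X,
    isFeasible_iff.2 ⟨hcode, ?_, nonneg_iff.2 (hY1.submatrix _), ?_⟩⟩
  · rw [margA₀B₀_submatrix]
    exact le_iff_posSemidef_sub.2 hY3
  · exact le_iff_posSemidef_sub.2 (hY2.submatrix (inOut A₀ A₁ B₀ B₁))

end Main

end BipartiteSim

end

theorem mainTheorem3 {A₀ B₀ A₁ B₁ : Type*}
    [Fintype A₀] [DecidableEq A₀] [Nonempty A₀] [Fintype B₀] [DecidableEq B₀] [Nonempty B₀]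
    [Fintype A₁] [DecidableEq A₁] [Fintype B₁] [DecidableEq B₁]
    (m : ℕ) (hm : 1 ≤ m)
    (N : BipartiteSim.Map (A₀ × B₀) (A₁ × B₁)) (hN : BipartiteSim.IsChannel N) :
    BipartiteSim.simError (BipartiteSim.bidirectional m) N ≠ ⊤ ∧
      IsLeast {μ : ℝ | ∃ Y Q V W X : BipartiteSim.Op ((A₀ × A₁) × (B₀ × B₁)),
          BipartiteSim.IsFeasible m N μ Y Q V W X}
        (BipartiteSim.simError (BipartiteSim.bidirectional m) N).toReal := by
  open BipartiteSim in
  -- A trace-preserving map from a nonzero space has a nonzero output space.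
  have hne : Nonempty (A₁ × B₁) := by
    by_contra hempty
    rw [not_nonempty_iff] at hempty
    have h := hN.tp 1
    rw [Matrix.trace_one, Matrix.trace_eq_zero_of_isEmpty] at h
    exact Fintype.card_ne_zero (α := A₀ × B₀) (by exact_mod_cast h.symm)
  obtain ⟨hA₁, hB₁⟩ := nonempty_prod.1 hne
  obtain ⟨μ₀, hμ₀, hleast⟩ := exists_isLeast_feasible hm hN
  have hμ₀' := hμ₀
  obtain ⟨Y, Q, V, W, X, hfeas⟩ := hμ₀
  have hpos := hfeas.nonneg
  have heq : simError (bidirectional m) N = ENNReal.ofReal μ₀ := by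
    refine le_antisymm (hfeas.simError_le hm hN hpos) ?_
    have h2 : ENNReal.ofReal μ₀ = 1 / 2 * ENNReal.ofReal (2 * μ₀) := by
      rw [ENNReal.ofReal_mul zero_le_two, ← mul_assoc, ENNReal.ofReal_ofNat, one_div,
        ENNReal.inv_mul_cancel two_ne_zero ENNReal.ofNat_ne_top, one_mul]
    rw [h2, simError]
    gcongr
    refine le_iInf₂ fun Θ hΘ => ?_
    by_cases htop : diamondNorm (Θ (bidirectional m) - N) = ⊤
    · rw [htop]
      exact le_top
    · set δ := (diamondNorm (Θ (bidirectional m) - N)).toReal with hδ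
      have hδd : diamondNorm (Θ (bidirectional m) - N) = ENNReal.ofReal δ :=
        (ENNReal.ofReal_toReal htop).symm
      have hδ0 : 0 ≤ δ := ENNReal.toReal_nonneg
      rw [hδd]
      refine ENNReal.ofReal_le_ofReal ?_
      have : μ₀ ≤ δ / 2 := le_of_forall_gt_imp_ge_of_dense fun μ hμ =>
        hleast (hΘ.exists_isFeasible hm hN (ν := δ / 2) (by positivity) hμ (by
          rw [hδd, mul_div_cancel₀ δ two_ne_zero]))
      linarith
  rw [heq, ENNReal.toReal_ofReal hpos]
  exact ⟨ENNReal.ofReal_ne_top, hμ₀', hleast⟩
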